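/- **Conventions.** A box $B\subset\mathbb C$ is a closed axis-aligned square with midpoint $m(B)$ and width $w(B)>0$; $sB$ is its central scaling, $r_B=w(B)/\sqrt2$, and $D(m,r)$ is the disc of centre $m$ and radius $r$. Write $f_k=f^{(k)}/k!$ and $\gamma(f,z)=\sup_{k\ge1}|f_k(z)/f(z)|^{1/k}\in[0,\infty]$. For $f(\alpha)\neq0$ let $R_f(\alpha)\in(0,\infty]$ be the largest radius of a disc around $\alpha$, contained in the domain of $f$, on which $z\mapsto(z-\alpha)f(z)$ is injective. **Clusters.** A cluster is a non-empty multiset $\mathcal C$ of roots of $f$ such that, for some disc $D$ and some $\lambda>1$ (with $\lambda D$ in the domain of $f$), $\mathcal C$ is the multiset of all roots of $f$ in $D$ and also of all roots in $\lambda D$, counted with multiplicity. Let $m_{\mathcal C}$ be its centroid, $r_{\mathcal C}$ the least $r$ with $\mathcal C\subset D(m_{\mathcal C},r)$, $h$ the holomorphic function with $f(z)=h(z)\prod_{\alpha\in\mathcal C}(z-\alpha)$, and $R_{\mathcal C}=|\mathcal C|/(c_0\,\gamma(h,m_{\mathcal C}))\in[0,\infty]$ with $c_0=2^{17}e^2$.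 The cluster is strongly separated if $r_{\mathcal C}\le R_{\mathcal C}/(8|\mathcal C|^3)$; then $D_{\mathcal C}=D(m_{\mathcal C},R_{\mathcal C}/|\mathcal C|^3)$, and $D_{\mathcal C}/3$ is the concentric disc with a third of the radius. For a box $B_0$, $S_0$ is the set of the strongly separated clusters contained in $2B_0$ that are maximal under inclusion among those. **Algorithm.** For each $k$ there is a box-function $\square f_k$, which maps every box $B$ in the domain of $f$ to a closed rectangle containing $f_k(B)$ such that $|z-w|\le \sup_B|f_{k+1}|\cdot 2(k+1)w(B)$ for all $z,w\in\square f_k(B)$. For a disc, $\square f_k(D(m,r))$ is the value at the smallest box centred at $m$ containing the disc, and $|\square f_k(\cdot)|$ is the largest absolute value of a point of the rectangle. The predicate $\widetilde C_k(m,r)$ holds if the soft comparison of $$a=|f_k(m)|r^k\quad\text{and}\quad b=\sum_{i<k}|f_i(m)|r^i+|\square f_{k+1}(D(m,r))|\,r^{k+1}$$ returns "positive". The soft comparison works with oracles for $a$ and $b$: at precision $p=1,2,4,8,\dots$ it obtains approximations $\tilde a,\tilde b$ with errors at most $2^{-p}$, and puts $I=[\tilde a-2^{-p},\tilde a+2^{-p}]$,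 $J=[\tilde b-2^{-p},\tilde b+2^{-p}]$. If $I\cap J=\emptyset$ it returns the sign of $I-J$; otherwise, if $\max(I\cup J)\le2\min(I\cup J)$, it returns "relatively close"; otherwise it goes on to the next precision. Let $c_1=32e$. The procedure $\mathrm{firstC}(B,N_0)$ returns the least $k\in\{0,\dots,N_0\}$ such that both $\widetilde C_k(m(B),\max\{1,c_1k\}\,r_B)$ and $\widetilde C_k(m(B),\max\{1,3c_1k\}\,r_B)$ hold, and $-1$ if there is none. The Yap–Sagraloff–Sharma soft root-clustering algorithm starts from $B_0$ and subdivides every box $B$ with $\mathrm{firstC}(B,N_0)=-1$ into its four congruent sub-boxes. The subdivision tree consists of all boxes that arise in this way; its size is its number of nodes. **Theorem.** There are absolute constants $M,K$ such that the following holds. Let $B_0$ be a box, let $N_0\ge0$ be an integer, and let $f$ be holomorphic on an open set $\Omega\supseteq K(N_0+1)B_0$ and not identically zero on $B_0$. Suppose that $f$ has at most $N_0$ roots in $B_0$, counted with multiplicity, and that $|\mathcal C|\le N_0$ for every $\mathcal C\in S_0$. Then, for all box-functions and oracles as above, the subdivision tree is finite, and with $E=B_0\setminus\bigcup_{\mathcal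 C\in S_0}D_{\mathcal C}/3$ its size is at most $$M\Bigl(1+|S_0|+\int_E\gamma(f,z)^2\,dA\Bigr).$$ Moreover $$|S_0|+\int_E\gamma(f,z)^2\,dA\;\le\;M\Bigl(|S_0|+\int_E\frac{dA}{R_f(z)^2}\Bigr),$$ and the size of the tree is at most $M\bigl(1+|S_0|+\int_E R_f(z)^{-2}\,dA\bigr)$. -/

import Mathlib

open MeasureTheory Set Filter Topology
open scoped ENNReal NNReal

namespace RootClustering

noncomputable section

/-! ### Analytic notions -/

/-- The normalized derivative `f_k(z) = f^{(k)}(z) / k!`. -/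
def normDeriv (f : ℂ → ℂ) (k : ℕ) (z : ℂ) : ℂ :=
  iteratedDeriv k f z / (k.factorial : ℂ)

/-- Smale's function `γ(f, z) = sup_{k ≥ 1} |f_k(z) / f(z)|^{1/k}`, with values in `[0, ∞]`.
The quotient is taken in `[0, ∞]`, so that `γ(f, z) = ∞` at a zero `z` of finite order. -/
def smaleGamma (f : ℂ → ℂ) (z : ℂ) : ℝ≥0∞ :=
  ⨆ (k : ℕ) (_ : 1 ≤ k), (‖normDeriv f k z‖ₑ / ‖f z‖ₑ) ^ (1 / (k : ℝ))

/-- The radius of univalence `R_f(α)`: the largest radius of an open disc around `α`, inside the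
domain `Ω` of `f`, on which the holomorphic function `z ↦ (z - α) f(z)` is injective. -/
def univalenceRadius (Ω : Set ℂ) (f : ℂ → ℂ) (α : ℂ) : ℝ≥0∞ :=
  ⨆ (r : ℝ≥0) (_ : Metric.ball α r ⊆ Ω ∧
    InjOn (fun z => (z - α) * f z) (Metric.ball α r)), (r : ℝ≥0∞)

/-! ### Squares -/

/-- An axis-aligned square box, given by its midpoint and its width. -/
@[ext] structure Square where
  center : ℂ
  width : ℝ

namespace Square

/-- The closed box itself. -/
def toSet (B : Square) : Set ℂ :=
  {z | |z.re - B.center.re| ≤ B.width / 2 ∧ |z.im - B.center.im| ≤ B.width / 2}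

/-- The centrally scaled box `s B`. -/
def scale (s : ℝ) (B : Square) : Square := ⟨B.center, s * B.width⟩

/-- `r_B`, the radius of the smallest disc centred at the midpoint of `B` that contains `B`. -/
def radius (B : Square) : ℝ := B.width / √2

/-- The smallest axis-aligned box centred at `m` that contains the disc `D(m, r)`. -/
def ofDisc (m : ℂ) (r : ℝ) : Square := ⟨m, 2 * r⟩

/-- The four equal boxes into which `B` is subdivided. -/
def children (B : Square) : Set Square :=
  {B' | B'.width = B.width / 2 ∧
    (B'.center.re = B.center.re - B.width / 4 ∨ B'.center.re = B.center.re + B.width / 4) ∧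
    (B'.center.im = B.center.im - B.width / 4 ∨ B'.center.im = B.center.im + B.width / 4)}

end Square

/-! ### Clusters of roots -/

open Classical in
/-- `C` is the multiset of all the roots of `f` in `D`, counted with multiplicity. -/
def IsRootMultiset (f : ℂ → ℂ) (D : Set ℂ) (C : Multiset ℂ) : Prop :=
  ∀ z, C.count z = if z ∈ D then analyticOrderNatAt f z else 0

/-- A cluster: a non-empty multiset of roots that consists of all the roots in some disc `D`, and
of all the roots in `λ D` for some `λ > 1`. -/
def IsCluster (Ω : Set ℂ) (f : ℂ → ℂ) (C : Multiset ℂ) : Prop :=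
  C ≠ 0 ∧ ∃ (c : ℂ) (r lam : ℝ), 0 < r ∧ 1 < lam ∧ Metric.closedBall c (lam * r) ⊆ Ω ∧
    IsRootMultiset f (Metric.closedBall c r) C ∧
    IsRootMultiset f (Metric.closedBall c (lam * r)) C

/-- The centroid `m_C`. -/
def centroid (C : Multiset ℂ) : ℂ := C.sum / (Multiset.card C : ℂ)

/-- `r_C`, the least `r` such that `D(m_C, r)` contains all the points of `C`. -/
def clusterRadius (C : Multiset ℂ) : ℝ := sInf {r : ℝ | ∀ α ∈ C, dist α (centroid C) ≤ r}

/-- The function `h` in the factorization `f(z) = h(z) ∏_{α ∈ C} (z - α)`: the quotient, extended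
to the points of `C` by continuity. -/
def cofactor (f : ℂ → ℂ) (C : Multiset ℂ) (z : ℂ) : ℂ :=
  limUnder (𝓝[≠] z) (fun w => f w / (C.map (fun α => w - α)).prod)

/-- The constant `c₀ = 2^17 e^2`. -/
def c₀ : ℝ := 2 ^ 17 * Real.exp 1 ^ 2

/-- `R_C = |C| / (c₀ γ_C(m_C))`, where `γ_C(z) = γ(h, z)`; it is `∞` if `γ_C(m_C) = 0`. -/
def sepRadius (f : ℂ → ℂ) (C : Multiset ℂ) : ℝ≥0∞ :=
  (Multiset.card C : ℝ≥0∞) / (ENNReal.ofReal c₀ * smaleGamma (cofactor f C) (centroid C))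

/-- Strongly separated clusters: `r_C ≤ R_C / (8 |C|^3)`. -/
def StronglySeparated (Ω : Set ℂ) (f : ℂ → ℂ) (C : Multiset ℂ) : Prop :=
  IsCluster Ω f C ∧
    ENNReal.ofReal (clusterRadius C) ≤ sepRadius f C / (8 * (Multiset.card C : ℝ≥0∞) ^ 3)

/-- The disc `D_C / 3`, where `D_C = D(m_C, R_C / |C|^3)`. -/
def thirdDisc (f : ℂ → ℂ) (C : Multiset ℂ) : Set ℂ :=
  {z | edist z (centroid C) ≤ sepRadius f C / (Multiset.card C : ℝ≥0∞) ^ 3 / 3}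

/-- The set `S₀` of the strongly separated clusters of roots in `2 B₀` that are maximal, with
respect to inclusion, among the strongly separated clusters of roots in `2 B₀`. -/
def maximalClusters (Ω : Set ℂ) (f : ℂ → ℂ) (B₀ : Square) : Set (Multiset ℂ) :=
  {C | Maximal (fun C' => StronglySeparated Ω f C' ∧ ∀ α ∈ C', α ∈ (B₀.scale 2).toSet) C}

/-- The region `B₀ \ ⋃_{C ∈ S₀} D_C / 3`. -/
def exclusionRegion (Ω : Set ℂ) (f : ℂ → ℂ) (B₀ : Square) : Set ℂ :=
  B₀.toSet \ ⋃ C ∈ maximalClusters Ω f B₀, thirdDisc f C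

/-! ### Box functions -/

/-- `F` is a box-function for the normalized derivative `f_k` on the domain `Ω`: it maps boxes to
closed rectangles, its value at `B` contains `f_k(B)`, and it has the first-order error bound
`|z - w| ≤ sup_B |f_{k+1}| * (2 (k+1) w(B))` for all `z, w` in its value at `B`. -/
def IsBoxFunction (Ω : Set ℂ) (f : ℂ → ℂ) (k : ℕ) (F : Square → Set ℂ) : Prop :=
  ∀ B : Square, 0 < B.width → B.toSet ⊆ Ω →
    (∃ a b c d : ℝ, F B = Icc a b ×ℂ Icc c d) ∧
    normDeriv f k '' B.toSet ⊆ F B ∧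
    ∀ z ∈ F B, ∀ w ∈ F B,
      ‖z - w‖ ≤ sSup ((fun ζ => ‖normDeriv f (k + 1) ζ‖) '' B.toSet) *
        (2 * ((k : ℝ) + 1) * B.width)

/-- The largest absolute value of a point of a set. -/
def magnitude (S : Set ℂ) : ℝ := sSup ((fun z => ‖z‖) '' S)

/-! ### The soft comparison of two real numbers -/

inductive CompareResult where
  | positive
  | negative
  | relativelyClose

/-- One round of the soft comparison, at precision `p`. Here `x` and `y` are oracles for two real
numbers, `x p` and `y p` being approximations with absolute error at most `2^{-p}`; so the numbers
lie in `[x p - 2^{-p}, x p + 2^{-p}]` and `[y p - 2^{-p}, y p + 2^{-p}]`. If these intervals are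
disjoint, the sign of the difference is returned. If no element of their union exceeds twice
another one, the numbers are reported to be relatively close. Otherwise the round is
inconclusive. -/
def compareRound (x y : ℕ → ℝ) (p : ℕ) : Option CompareResult :=
  let ε : ℝ := (2 : ℝ)⁻¹ ^ p
  if y p + ε < x p - ε then some .positive
  else if x p + ε < y p - ε then some .negative
  else if max (x p + ε) (y p + ε) ≤ 2 * min (x p - ε) (y p - ε) then some .relativelyClose
  else none

/-- The soft comparison, run at precisions `p = 1, 2, 4, 8, …`, stops with the result `res`. -/
def SoftCompare (x y : ℕ → ℝ) (res : CompareResult) : Prop :=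
  ∃ n : ℕ, compareRound x y (2 ^ n) = some res ∧ ∀ i < n, compareRound x y (2 ^ i) = none

/-- `x` is an oracle for the real number `a`. -/
def IsOracle (x : ℕ → ℝ) (a : ℝ) : Prop := ∀ p : ℕ, |x p - a| ≤ (2 : ℝ)⁻¹ ^ p

/-! ### The algorithm -/

/-- What the algorithm has access to: a function `boxFn k` for every normalized derivative `f_k`,
and oracles for the two quantities that are compared in the test with index `k` on the disc
`D(m, r)`. -/
structure Access where
  boxFn : ℕ → Square → Set ℂ
  lhsOracle : ℕ → ℂ → ℝ → ℕ → ℝ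
  rhsOracle : ℕ → ℂ → ℝ → ℕ → ℝ

/-- The left-hand side `|f_k(m)| r^k` of the test. -/
def testLhs (f : ℂ → ℂ) (k : ℕ) (m : ℂ) (r : ℝ) : ℝ := ‖normDeriv f k m‖ * r ^ k

/-- The right-hand side `∑_{i < k} |f_i(m)| r^i + |□f_{k+1}(D(m, r))| r^{k+1}` of the test. -/
def testRhs (f : ℂ → ℂ) (boxFn : ℕ → Square → Set ℂ) (k : ℕ) (m : ℂ) (r : ℝ) : ℝ :=
  ∑ i ∈ Finset.range k, ‖normDeriv f i m‖ * r ^ i +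
    magnitude (boxFn (k + 1) (Square.ofDisc m r)) * r ^ (k + 1)

/-- The access data are correct for the function `f` on `Ω`. -/
structure Access.Valid (A : Access) (Ω : Set ℂ) (f : ℂ → ℂ) : Prop where
  boxFn : ∀ k, IsBoxFunction Ω f k (A.boxFn k)
  lhsOracle : ∀ k m r, IsOracle (A.lhsOracle k m r) (testLhs f k m r)
  rhsOracle : ∀ k m r, IsOracle (A.rhsOracle k m r) (testRhs f A.boxFn k m r)

/-- The predicate `C̃_k(m, r)`: the soft comparison returns a positive sign. -/
def SoftTest (A : Access) (k : ℕ) (m : ℂ) (r : ℝ) : Prop :=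
  SoftCompare (A.lhsOracle k m r) (A.rhsOracle k m r) .positive

/-- The predicate `C̃_k(B)`, on the smallest disc centred at the midpoint of `B` containing `B`. -/
def SoftTestBox (A : Access) (k : ℕ) (B : Square) : Prop := SoftTest A k B.center B.radius

/-- The constant `c₁ = 32 e`. -/
def c₁ : ℝ := 32 * Real.exp 1

open Classical in
/-- The procedure `firstC`: the smallest `k ≤ N₀` such that `C̃_k` holds for the boxes
`max{1, c₁ k} B` and `max{1, 3 c₁ k} B`, and `-1` if there is none. -/
def firstC (A : Access) (N₀ : ℕ) (B : Square) : ℤ :=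
  if h : ∃ k : ℕ, k ≤ N₀ ∧ SoftTestBox A k (B.scale (max 1 (c₁ * k))) ∧
      SoftTestBox A k (B.scale (max 1 (3 * c₁ * k)))
  then (Nat.find h : ℤ) else -1

/-- The boxes of the subdivision tree: `B₀` belongs to it, and a box of the tree at which `firstC`
returns `-1` is subdivided into its four children. -/
inductive InTree (A : Access) (N₀ : ℕ) (B₀ : Square) : Square → Prop
  | root : InTree A N₀ B₀ B₀
  | child {B B' : Square} : InTree A N₀ B₀ B → firstC A N₀ B = -1 → B' ∈ B.children →
      InTree A N₀ B₀ B'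

/-- The set of nodes of the subdivision tree. -/
def subdivisionTree (A : Access) (N₀ : ℕ) (B₀ : Square) : Set Square := {B | InTree A N₀ B₀ B}

/-- `∫ γ(f, z)^2 dA` over the region `B₀ \ ⋃_{C ∈ S₀} D_C / 3`. -/
def gammaIntegral (Ω : Set ℂ) (f : ℂ → ℂ) (B₀ : Square) : ℝ≥0∞ :=
  ∫⁻ z in exclusionRegion Ω f B₀, smaleGamma f z ^ 2

/-- `∫ dA / R_f(z)^2` over the region `B₀ \ ⋃_{C ∈ S₀} D_C / 3`. -/
def univalenceIntegral (Ω : Set ℂ) (f : ℂ → ℂ) (B₀ : Square) : ℝ≥0∞ :=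
  ∫⁻ z in exclusionRegion Ω f B₀, 1 / univalenceRadius Ω f z ^ 2

end

end RootClustering

namespace RootClustering

/-! ### The soft comparison -/

/-! Every node of the tree other than the root is a child of an internal node, so it suffices to
count the boxes `B` at which `firstC` fails. Write 1 as the integral over `B` of `1 / |B|`, where
`|B|` is the area, and exchange sum and integral. At a point `z` of `B₀`, each level of the
subdivision has at most four boxes containing `z`, and `1 / |B|` grows by a factor 4 per level. The
sum of `1 / |B|` over the failing boxes around `z` is therefore at most 8 times any common bound for
its terms (`tsum_inv_volume_le`), and such a bound is needed at each `z`.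

The source of these bounds is `softTest_of_factorization`. If `f = h P` near a disc, with `P` monic
of degree `k`, its roots close to the midpoint, and `γ(h)` small, then `f` is a small perturbation
of a constant times `P`. The `k`-th Taylor term then dominates all others with a margin exceeding
the factor 2 of the soft comparison, so the test succeeds. It is used in two ways. On `E`, take `k =
0` and `h = f`: failure at `B` forces `γ(f, z) > 1 / (2000 r_B)`, so `1 / |B|` is at most a constant
times `γ(f, z)^2`. These points contribute the integral of `γ^2`. On a disc `D_C / 3` with `C ∈ S₀`,
take the factorization given by `C`: failure at `B` forces `r_B > ρ / 4`, where `ρ` is the radius of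
`D_C` (`Admissible.discRadius_lt`), so `1 / |B| ≤ 8 / ρ^2`. Integrated over the disc this is a
constant, so each cluster contributes `O(1)`.

The comparison with `R_f` is the pointwise inequality `γ(f, α) ≤ 10^5 / R_f(α)`. A crude growth
theorem for univalent functions, proved by Koebe's square-root trick (`norm_le_of_injOn_id_mul`),
bounds `f` on a disc of radius comparable to `R_f(α)`, and Cauchy's estimates then bound `γ`.
Finiteness of the tree is a separate compactness argument. -/

theorem softCompare_positive {x y : ℕ → ℝ} {a b : ℝ} (hx : IsOracle x a) (hy : IsOracle y b)
    (hb : 0 ≤ b) (hab : 2 * b < a) : SoftCompare x y .positive := by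
  have bounds : ∀ p, a ≤ x p + (2 : ℝ)⁻¹ ^ p ∧ x p - (2 : ℝ)⁻¹ ^ p ≤ a ∧
      b ≤ y p + (2 : ℝ)⁻¹ ^ p ∧ y p - (2 : ℝ)⁻¹ ^ p ≤ b := fun p => by
    have h₁ := abs_le.1 (hx p)
    have h₂ := abs_le.1 (hy p)
    refine ⟨?_, ?_, ?_, ?_⟩ <;> linarith [h₁.1, h₁.2, h₂.1, h₂.2]
  -- The intervals contain `a` and `b`, so `a > 2 b ≥ 0` rules out the two wrong answers at every
  -- precision: a round is either inconclusive or positive.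
  have dich : ∀ p, compareRound x y p = some .positive ∨ compareRound x y p = none := fun p => by
    obtain ⟨h₁, h₂, h₃, h₄⟩ := bounds p
    by_cases hpos : y p + (2 : ℝ)⁻¹ ^ p < x p - (2 : ℝ)⁻¹ ^ p
    · exact .inl (if_pos hpos)
    right
    have hneg : ¬ x p + (2 : ℝ)⁻¹ ^ p < y p - (2 : ℝ)⁻¹ ^ p := by linarith
    have hclose : ¬ max (x p + (2 : ℝ)⁻¹ ^ p) (y p + (2 : ℝ)⁻¹ ^ p) ≤
        2 * min (x p - (2 : ℝ)⁻¹ ^ p) (y p - (2 : ℝ)⁻¹ ^ p) := by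
      have := le_max_left (x p + (2 : ℝ)⁻¹ ^ p) (y p + (2 : ℝ)⁻¹ ^ p)
      have := min_le_right (x p - (2 : ℝ)⁻¹ ^ p) (y p - (2 : ℝ)⁻¹ ^ p)
      linarith
    simp only [compareRound, hpos, hneg, hclose, if_false]
  have ex : ∃ n, compareRound x y (2 ^ n) = some .positive := by
    -- Each relevant endpoint is within `2 ε` of the true value, so the intervals separate once `4 ε
    -- < a - b`.
    obtain ⟨n, hn⟩ := exists_pow_lt_of_lt_one (show (0 : ℝ) < (a - b) / 4 by linarith)
      (show (2 : ℝ)⁻¹ < 1 by norm_num)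
    refine ⟨n, if_pos ?_⟩
    have hle : (2 : ℝ)⁻¹ ^ (2 ^ n) ≤ (2 : ℝ)⁻¹ ^ n :=
      pow_le_pow_of_le_one (by norm_num) (by norm_num) Nat.lt_two_pow_self.le
    have h₁ := abs_le.1 (hx (2 ^ n))
    have h₂ := abs_le.1 (hy (2 ^ n))
    linarith [h₁.1, h₁.2, h₂.1, h₂.2]
  classical
  exact ⟨Nat.find ex, Nat.find_spec ex, fun i hi => (dich _).resolve_left (Nat.find_min ex hi)⟩

/-! ### Normalized derivatives -/

theorem normDeriv_congr {f g : ℂ → ℂ} {z : ℂ} (h : f =ᶠ[𝓝 z] g) (k : ℕ) :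
    normDeriv f k z = normDeriv g k z := by
  simp only [normDeriv, (h.iteratedDeriv k).eq_of_nhds]

theorem normDeriv_zero (f : ℂ → ℂ) (z : ℂ) : normDeriv f 0 z = f z := by
  simp [normDeriv]

theorem normDeriv_add {f g : ℂ → ℂ} {z : ℂ} (hf : AnalyticAt ℂ f z) (hg : AnalyticAt ℂ g z)
    (k : ℕ) : normDeriv (fun w => f w + g w) k z = normDeriv f k z + normDeriv g k z := by
  have := iteratedDeriv_fun_add (n := k) hf.contDiffAt hg.contDiffAt
  simp only [normDeriv, this, add_div]

theorem normDeriv_const_mul {f : ℂ → ℂ} {z : ℂ} (c : ℂ) (k : ℕ) :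
    normDeriv (fun w => c * f w) k z = c * normDeriv f k z := by
  simp only [normDeriv, iteratedDeriv_const_mul_field, mul_div_assoc]

theorem norm_normDeriv_le {f : ℂ → ℂ} {z : ℂ} {s C : ℝ} (hs : 0 < s)
    (hf : DiffContOnCl ℂ f (Metric.ball z s)) (hC : ∀ w ∈ Metric.sphere z s, ‖f w‖ ≤ C) (k : ℕ) :
    ‖normDeriv f k z‖ ≤ C / s ^ k := by
  have := Complex.norm_iteratedDeriv_le_of_forall_mem_sphere_norm_le k hs hf hC
  rw [normDeriv, norm_div, Complex.norm_natCast, div_le_iff₀ (by positivity)]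
  calc _ ≤ _ := this
    _ = _ := by ring

/-- Leibniz' rule, in which a linear factor leaves only two terms. It is the recursion behind all
facts on the Taylor coefficients of `rootProd`. -/
theorem normDeriv_succ_linear_mul {f : ℂ → ℂ} {z : ℂ} (a : ℂ) (hf : AnalyticAt ℂ f z) (k : ℕ) :
    normDeriv (fun w => (w - a) * f w) (k + 1) z =
      (z - a) * normDeriv f (k + 1) z + normDeriv f k z := by
  have hlin : ContDiffAt ℂ (k + 1 : ℕ) (fun w : ℂ => w - a) z := by fun_prop
  have key : iteratedDeriv (k + 1) (fun w => (w - a) * f w) z =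
      (z - a) * iteratedDeriv (k + 1) f z + (k + 1) * iteratedDeriv k f z := by
    have h := iteratedDeriv_fun_mul hlin (hf.contDiffAt (n := (k + 1 : ℕ)))
    rw [h, Finset.sum_range_succ', Finset.sum_range_succ']
    have h0 : ∀ i, iteratedDeriv (i + 1) (fun w : ℂ => w - a) z = if i = 0 then 1 else 0 := by
      intro i
      rw [iteratedDeriv_succ']
      have : deriv (fun w : ℂ => w - a) = fun _ => 1 := by ext; simp
      rw [this, iteratedDeriv_const]
    rw [Finset.sum_eq_zero]
    · simp [h0]; ring
    · intro i _
      simp [h0]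
  rw [normDeriv, normDeriv, normDeriv, key, Nat.factorial_succ]
  have : (k.factorial : ℂ) ≠ 0 := by exact_mod_cast k.factorial_ne_zero
  have : (k + 1 : ℂ) ≠ 0 := by exact_mod_cast k.succ_ne_zero
  push_cast
  field_simp

/-! ### Products of linear factors -/

/-- The monic polynomial function with the multiset of roots `C`. -/
noncomputable def rootProd (C : Multiset ℂ) (z : ℂ) : ℂ := (C.map (fun α => z - α)).prod

@[simp] theorem rootProd_zero (z : ℂ) : rootProd 0 z = 1 := by simp [rootProd]

@[simp] theorem rootProd_cons (α : ℂ) (C : Multiset ℂ) (z : ℂ) :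
    rootProd (α ::ₘ C) z = (z - α) * rootProd C z := by simp [rootProd]

theorem differentiable_rootProd (C : Multiset ℂ) : Differentiable ℂ (rootProd C) := by
  induction C using Multiset.induction_on with
  | empty => simp [funext rootProd_zero]
  | cons α C ih =>
    rw [funext (rootProd_cons α C)]
    fun_prop

theorem analyticAt_rootProd (C : Multiset ℂ) (z : ℂ) : AnalyticAt ℂ (rootProd C) z :=
  (differentiable_rootProd C).analyticAt z

theorem rootProd_eq_zero {C : Multiset ℂ} {z : ℂ} : rootProd C z = 0 ↔ z ∈ C := by
  simp only [rootProd, Multiset.prod_eq_zero_iff, Multiset.mem_map, sub_eq_zero]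
  exact ⟨fun ⟨a, ha, h⟩ => h ▸ ha, fun h => ⟨z, h, rfl⟩⟩

theorem norm_rootProd_le {C : Multiset ℂ} {z : ℂ} {T : ℝ} (h : ∀ α ∈ C, ‖z - α‖ ≤ T) :
    ‖rootProd C z‖ ≤ T ^ Multiset.card C := by
  induction C using Multiset.induction_on with
  | empty => simp
  | cons α C ih =>
    rw [rootProd_cons, norm_mul, Multiset.card_cons, pow_succ']
    have hα := h α (by simp)
    exact mul_le_mul hα (ih fun β hβ => h β (by simp [hβ])) (norm_nonneg _)
      ((norm_nonneg _).trans hα)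

theorem normDeriv_rootProd_of_card_lt {C : Multiset ℂ} {z : ℂ} {i : ℕ}
    (h : Multiset.card C < i) : normDeriv (rootProd C) i z = 0 := by
  induction C using Multiset.induction_on generalizing i with
  | empty =>
    obtain ⟨j, rfl⟩ := Nat.exists_eq_succ_of_ne_zero (by simpa using h.ne' : i ≠ 0)
    simp [funext rootProd_zero, normDeriv, iteratedDeriv_const]
  | cons α C ih =>
    rw [Multiset.card_cons] at h
    obtain ⟨j, rfl⟩ := Nat.exists_eq_succ_of_ne_zero (by omega : i ≠ 0)
    rw [funext (rootProd_cons α C), Nat.succ_eq_add_one,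
      normDeriv_succ_linear_mul _ (analyticAt_rootProd C z), ih (by omega), ih (by omega)]
    simp

theorem normDeriv_rootProd_card (C : Multiset ℂ) (z : ℂ) :
    normDeriv (rootProd C) (Multiset.card C) z = 1 := by
  induction C using Multiset.induction_on with
  | empty => simp [normDeriv_zero]
  | cons α C ih =>
    rw [Multiset.card_cons, funext (rootProd_cons α C),
      normDeriv_succ_linear_mul _ (analyticAt_rootProd C z), ih,
      normDeriv_rootProd_of_card_lt (Nat.lt_succ_self _)]
    simp

/-- The weighted sum of absolute Taylor coefficients is submultiplicative, and each linear factor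
contributes at most `r + ρ`. -/
theorem sum_norm_normDeriv_rootProd_le {C : Multiset ℂ} {z : ℂ} {ρ r : ℝ} (hr : 0 ≤ r)
    (h : ∀ α ∈ C, ‖z - α‖ ≤ ρ) :
    ∑ i ∈ Finset.range (Multiset.card C + 1), ‖normDeriv (rootProd C) i z‖ * r ^ i ≤
      (r + ρ) ^ Multiset.card C := by
  induction C using Multiset.induction_on with
  | empty => simp [normDeriv_zero]
  | cons α C ih =>
    have hα := h α (by simp)
    have hρ := (norm_nonneg _).trans hα
    specialize ih fun β hβ => h β (by simp [hβ])
    set S := ∑ i ∈ Finset.range (Multiset.card C + 1), ‖normDeriv (rootProd C) i z‖ * r ^ i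
    have hS : ∑ i ∈ Finset.range (Multiset.card C + 2), ‖normDeriv (rootProd C) i z‖ * r ^ i =
        S := by
      rw [Finset.sum_range_succ, normDeriv_rootProd_of_card_lt (by omega)]
      simp [S]
    rw [Multiset.card_cons, Finset.sum_range_succ', funext (rootProd_cons α C)]
    calc _ ≤ (∑ i ∈ Finset.range (Multiset.card C + 1),
            (ρ * (‖normDeriv (rootProd C) (i + 1) z‖ * r ^ (i + 1)) +
              r * (‖normDeriv (rootProd C) i z‖ * r ^ i))) +
            ρ * (‖normDeriv (rootProd C) 0 z‖ * r ^ 0) := by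
          refine add_le_add (Finset.sum_le_sum fun i _ => ?_) ?_
          · rw [normDeriv_succ_linear_mul _ (analyticAt_rootProd C z)]
            calc _ ≤ (ρ * ‖normDeriv (rootProd C) (i + 1) z‖ + ‖normDeriv (rootProd C) i z‖) *
                  r ^ (i + 1) := by
                  refine mul_le_mul_of_nonneg_right ((norm_add_le _ _).trans ?_) (by positivity)
                  rw [norm_mul]
                  gcongr
              _ = _ := by ring
          · rw [normDeriv_zero, normDeriv_zero, norm_mul, mul_assoc]
            gcongr
      _ = ρ * (∑ i ∈ Finset.range (Multiset.card C + 2),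
            ‖normDeriv (rootProd C) i z‖ * r ^ i) + r * S := by
          rw [Finset.sum_add_distrib, ← Finset.mul_sum, ← Finset.mul_sum,
            Finset.sum_range_succ' _ (Multiset.card C + 1)]
          ring
      _ ≤ (r + ρ) ^ (Multiset.card C + 1) := by
          rw [hS, ← add_mul, pow_succ', add_comm ρ r]
          gcongr

/-! ### Smale's function -/

theorem norm_normDeriv_le_of_smaleGamma_le {h : ℂ → ℂ} {z : ℂ} {Γ : ℝ} (hΓ : 0 ≤ Γ) (hz : h z ≠ 0)
    (hγ : smaleGamma h z ≤ ENNReal.ofReal Γ) (k : ℕ) :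
    ‖normDeriv h k z‖ ≤ ‖h z‖ * Γ ^ k := by
  rcases Nat.eq_zero_or_pos k with rfl | hk
  · simp [normDeriv_zero]
  have h₁ : (‖normDeriv h k z‖ₑ / ‖h z‖ₑ) ^ (1 / (k : ℝ)) ≤ ENNReal.ofReal Γ :=
    (le_iSup₂_of_le k hk le_rfl).trans hγ
  have hk' : (0 : ℝ) < k := by exact_mod_cast hk
  rw [one_div, ENNReal.rpow_inv_le_iff hk', ENNReal.rpow_natCast,
    ENNReal.div_le_iff (by simpa using hz) (by simp), ← ENNReal.ofReal_pow hΓ,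
    ← ofReal_norm, ← ofReal_norm, ← ENNReal.ofReal_mul (by positivity),
    ENNReal.ofReal_le_ofReal_iff (by positivity)] at h₁
  linarith [mul_comm ‖h z‖ (Γ ^ k)]

theorem smaleGamma_le_of_norm_normDeriv_le {h : ℂ → ℂ} {z : ℂ} {Γ : ℝ} (hΓ : 0 ≤ Γ) (hz : h z ≠ 0)
    (hd : ∀ k, 1 ≤ k → ‖normDeriv h k z‖ ≤ ‖h z‖ * Γ ^ k) :
    smaleGamma h z ≤ ENNReal.ofReal Γ := by
  refine iSup₂_le fun k hk => ?_
  have hk' : (0 : ℝ) < k := by exact_mod_cast hk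
  rw [one_div, ENNReal.rpow_inv_le_iff hk', ENNReal.rpow_natCast,
    ENNReal.div_le_iff (by simpa using hz) (by simp), ← ENNReal.ofReal_pow hΓ,
    ← ofReal_norm, ← ofReal_norm, ← ENNReal.ofReal_mul (by positivity),
    ENNReal.ofReal_le_ofReal_iff (by positivity)]
  linarith [mul_comm ‖h z‖ (Γ ^ k), hd k hk]

/-- A function with finite `γ` extends holomorphically to the disc of radius `1 / γ`. -/
theorem exists_extension_of_smaleGamma_le {h : ℂ → ℂ} {z₀ : ℂ} {L Γ : ℝ} (hΓ : 0 < Γ)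
    (hh : DifferentiableOn ℂ h (Metric.ball z₀ L)) (hz : h z₀ ≠ 0)
    (hγ : smaleGamma h z₀ ≤ ENNReal.ofReal Γ) :
    ∃ H : ℂ → ℂ, DifferentiableOn ℂ H (Metric.ball z₀ Γ⁻¹) ∧
      (∀ z ∈ Metric.ball z₀ L, z ∈ Metric.ball z₀ Γ⁻¹ → H z = h z) ∧
      ∀ z, Γ * ‖z - z₀‖ ≤ 1 / 2 → ‖H z - h z₀‖ ≤ 2 * Γ * ‖z - z₀‖ * ‖h z₀‖ := by
  have hd := norm_normDeriv_le_of_smaleGamma_le hΓ.le hz hγ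
  -- The bounds `|h_n(z₀)| ≤ |h(z₀)| Γ^n` give the Taylor series of `h` a radius of convergence at
  -- least `1 / Γ`, however small the ball on which `h` is given.
  set p : FormalMultilinearSeries ℂ ℂ ℂ :=
    FormalMultilinearSeries.ofScalars ℂ (fun n => normDeriv h n z₀) with hp
  have hrad : ENNReal.ofReal Γ⁻¹ ≤ p.radius := by
    refine p.le_radius_of_bound (r := Real.toNNReal Γ⁻¹) ‖h z₀‖ fun n => ?_
    rw [hp, FormalMultilinearSeries.ofScalars_norm, Real.coe_toNNReal _ (by positivity), inv_pow,
      ← div_eq_mul_inv, div_le_iff₀ (by positivity)]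
    exact hd n
  have hpos : 0 < p.radius := lt_of_lt_of_le (by simpa using hΓ) hrad
  have hps : HasFPowerSeriesOnBall (fun z => p.sum (z - z₀)) p z₀ p.radius := by
    simpa using (p.hasFPowerSeriesOnBall hpos).comp_sub z₀
  have hsub : Metric.ball z₀ Γ⁻¹ ⊆ Metric.eball z₀ p.radius := by
    rw [← Metric.eball_ofReal]
    exact Metric.eball_subset_eball hrad
  refine ⟨fun z => p.sum (z - z₀), hps.differentiableOn.mono hsub, ?_, ?_⟩
  · intro z hzL hzΓ
    have h₁ := Complex.hasSum_taylorSeries_on_ball hh hzL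
    have h₂ := hps.hasSum_sub (hsub hzΓ)
    refine h₂.unique ?_
    convert h₁ using 2 with n
    simp only [hp, normDeriv, smul_eq_mul]
    simp [div_eq_mul_inv]; ring
  · intro z hz'
    set q := Γ * ‖z - z₀‖ with hq
    have hq0 : 0 ≤ q := by positivity
    have hzΓ : z ∈ Metric.ball z₀ Γ⁻¹ := by
      rw [mem_ball_iff_norm, ← one_div, lt_div_iff₀' hΓ]
      linarith
    have h₂ := (hasSum_nat_add_iff' 1).2 (hps.hasSum_sub (hsub hzΓ))
    have hgeo := ((hasSum_geometric_of_lt_one hq0 (by linarith)).mul_left q).mul_left ‖h z₀‖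
    have h₃ := h₂.norm_le_of_bounded hgeo fun n => by
      simp only [hp, FormalMultilinearSeries.ofScalars_apply_eq, smul_eq_mul, norm_mul, norm_pow]
      calc _ ≤ ‖h z₀‖ * Γ ^ (n + 1) * ‖z - z₀‖ ^ (n + 1) := by
            gcongr
            exact hd _
        _ = _ := by rw [hq]; ring
    have h₄ : p.sum (z - z₀) - h z₀ = p.sum (z - z₀) -
        ∑ i ∈ Finset.range 1, (p i) fun _ => z - z₀ := by
      simp [hp, normDeriv_zero]
    have h₅ : (1 - q)⁻¹ ≤ 2 := by
      rw [inv_le_comm₀ (by linarith) (by norm_num)]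
      linarith
    calc ‖p.sum (z - z₀) - h z₀‖ ≤ ‖h z₀‖ * (q * (1 - q)⁻¹) := by rw [h₄]; exact h₃
      _ ≤ ‖h z₀‖ * (q * 2) := by gcongr
      _ = _ := by rw [hq]; ring

/-! ### The test succeeds in the presence of a factorization -/

theorem Square.mem_toSet_center {B : Square} (hB : 0 ≤ B.width) : B.center ∈ B.toSet := by
  simp only [Square.toSet, Set.mem_ofPred_eq, sub_self, abs_zero]
  constructor <;> linarith

theorem Square.norm_sub_center_le {B : Square} {z : ℂ} (hz : z ∈ B.toSet) :
    ‖z - B.center‖ ≤ B.radius := by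
  obtain ⟨h₁, h₂⟩ := hz
  have hw : 0 ≤ B.width := by linarith [abs_nonneg (z.re - B.center.re)]
  rw [Complex.norm_eq_sqrt_sq_add_sq, Square.radius]
  apply Real.sqrt_le_iff.2
  refine ⟨by positivity, ?_⟩
  rw [div_pow, Real.sq_sqrt (by norm_num)]
  simp only [Complex.sub_re, Complex.sub_im]
  have := sq_le_sq' (abs_le.1 h₁).1 (abs_le.1 h₁).2
  have := sq_le_sq' (abs_le.1 h₂).1 (abs_le.1 h₂).2
  linarith

theorem magnitude_nonneg (S : Set ℂ) : 0 ≤ magnitude S := by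
  apply Real.sSup_nonneg
  rintro _ ⟨z, _, rfl⟩
  exact norm_nonneg z

theorem IsBoxFunction.magnitude_le {Ω : Set ℂ} {f : ℂ → ℂ} {k : ℕ} {F : Square → Set ℂ}
    (hF : IsBoxFunction Ω f k F) {B : Square} (hB : 0 < B.width) (hBΩ : B.toSet ⊆ Ω) {M₁ M₂ : ℝ}
    (h₁ : ‖normDeriv f k B.center‖ ≤ M₁) (h₂ : ∀ ζ ∈ B.toSet, ‖normDeriv f (k + 1) ζ‖ ≤ M₂) :
    magnitude (F B) ≤ M₁ + M₂ * (2 * ((k : ℝ) + 1) * B.width) := by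
  obtain ⟨-, himg, hdiam⟩ := hF B hB hBΩ
  have hc := Square.mem_toSet_center hB.le
  have hcF : normDeriv f k B.center ∈ F B := himg ⟨_, hc, rfl⟩
  refine csSup_le ⟨_, _, hcF, rfl⟩ ?_
  rintro _ ⟨w, hw, rfl⟩
  have hsup : sSup ((fun ζ => ‖normDeriv f (k + 1) ζ‖) '' B.toSet) ≤ M₂ := by
    refine csSup_le ⟨_, _, hc, rfl⟩ ?_
    rintro _ ⟨ζ, hζ, rfl⟩
    exact h₂ ζ hζ
  calc ‖w‖ ≤ ‖normDeriv f k B.center‖ + ‖w - normDeriv f k B.center‖ := norm_le_insert' _ _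
    _ ≤ M₁ + M₂ * (2 * ((k : ℝ) + 1) * B.width) := by
      refine add_le_add h₁ ((hdiam w hw _ hcF).trans ?_)
      gcongr

/-- Both sides are compared with `exp x`. -/
theorem one_add_div_pow_le {x y : ℝ} (hx1 : x < 1) {n : ℕ} (hy : 0 ≤ y)
    (hn : n * y ≤ x) : (1 + y) ^ n ≤ 1 / (1 - x) := by
  calc (1 + y) ^ n ≤ Real.exp y ^ n := by
        gcongr
        linarith [Real.add_one_le_exp y]
    _ = Real.exp (n * y) := by rw [← Real.exp_nat_mul]
    _ ≤ Real.exp x := Real.exp_le_exp.2 hn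
    _ ≤ 1 / (1 - x) := by
        rw [le_div_iff₀ (by linarith)]
        calc Real.exp x * (1 - x) ≤ Real.exp x * Real.exp (-x) := by
              gcongr
              linarith [Real.add_one_le_exp (-x)]
          _ = 1 := by rw [← Real.exp_add, add_neg_cancel, Real.exp_zero]

/-- If all roots of `f` near the disc `D(m, r)` are the `k` points of `C`, all of them close to `m`,
and if the cofactor has small `γ`, then the test `C̃_k(m, r)` succeeds. -/
theorem softTest_of_factorization {Ω : Set ℂ} {f h : ℂ → ℂ} {A : Access} (hA : A.Valid Ω f)
    {m z₀ : ℂ} {r : ℝ} (hr : 0 < r) (C : Multiset ℂ)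
    (hroots : ∀ α ∈ C, ‖m - α‖ ≤ r / (17 * Multiset.card C)) (hz₀ : ‖m - z₀‖ ≤ r)
    (hΩ : Metric.ball z₀ (3 * r) ⊆ Ω) (hh : DifferentiableOn ℂ h (Metric.ball z₀ (3 * r)))
    (hfac : ∀ z ∈ Metric.ball z₀ (3 * r), f z = h z * rootProd C z) (hne : h z₀ ≠ 0)
    (hγ : smaleGamma h z₀ ≤ ENNReal.ofReal (1 / (2000 * (Multiset.card C + 1) * r))) :
    SoftTest A (Multiset.card C) m r := by
  set k := Multiset.card C with hk
  have hk1 : (1 : ℝ) ≤ k + 1 := by simp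
  set Γ : ℝ := 1 / (2000 * (k + 1) * r) with hΓ
  have hΓpos : 0 < Γ := by positivity
  have hΓinv : Γ⁻¹ = 2000 * (k + 1) * r := by rw [hΓ, one_div, inv_inv]
  have hΓr : Γ * ((k + 1) * r) = 1 / 2000 := by
    rw [hΓ]; field_simp
  -- The Cauchy circles used below have radius of order `(k + 1) r` and leave the ball of radius `3
  -- r` on which `h` is given. The extension `H` is available up to radius `2000 (k + 1) r`. On the
  -- small ball, `f` is the model `h₀ P` plus the remainder `E`.
  obtain ⟨H, hHd, hHh, hHb⟩ := exists_extension_of_smaleGamma_le hΓpos hh hne hγ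
  set h₀ := h z₀
  set E : ℂ → ℂ := fun z => (H z - h₀) * rootProd C z with hE
  have hkr : r ≤ (k + 1) * r := by nlinarith
  have hEd : DifferentiableOn ℂ E (Metric.ball z₀ Γ⁻¹) :=
    (hHd.sub_const h₀).mul (differentiable_rootProd C).differentiableOn
  have hballsub : Metric.ball z₀ (3 * r) ⊆ Metric.ball z₀ Γ⁻¹ :=
    Metric.ball_subset_ball (by rw [hΓinv]; linarith)
  have hderiv : ∀ z ∈ Metric.ball z₀ (3 * r), ∀ i,
      normDeriv f i z = h₀ * normDeriv (rootProd C) i z + normDeriv E i z := by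
    intro z hz i
    have hev : f =ᶠ[𝓝 z] fun w => h₀ * rootProd C w + E w := by
      filter_upwards [Metric.isOpen_ball.mem_nhds hz] with w hw
      rw [hfac w hw, ← hHh w hw (hballsub hw)]
      simp only [hE]; ring
    rw [normDeriv_congr hev, normDeriv_add, normDeriv_const_mul]
    · exact analyticAt_const.mul (analyticAt_rootProd C z)
    · exact hEd.analyticAt (Metric.isOpen_ball.mem_nhds (hballsub hz))
  -- Cauchy estimates for the remainder `E`
  have hcauchy : ∀ (c : ℂ) (s D T : ℝ), 0 < s → (∀ w ∈ Metric.closedBall c s, ‖w - z₀‖ ≤ D) →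
      (∀ w ∈ Metric.closedBall c s, ∀ α ∈ C, ‖w - α‖ ≤ T) → Γ * D ≤ 1 / 2 → ∀ i,
      ‖normDeriv E i c‖ ≤ 2 * (Γ * D) * ‖h₀‖ * T ^ k / s ^ i := by
    intro c s D T hs hD hT hΓD i
    have hD0 : 0 ≤ D := (norm_nonneg _).trans (hD c (Metric.mem_closedBall_self hs.le))
    refine norm_normDeriv_le hs ?_ ?_ i
    · refine DifferentiableOn.diffContOnCl ?_
      rw [closure_ball _ hs.ne']
      refine hEd.mono fun w hw => ?_
      rw [mem_ball_iff_norm, ← one_div, lt_div_iff₀' hΓpos]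
      have := mul_le_mul_of_nonneg_left (hD w hw) hΓpos.le
      linarith
    · intro w hw
      have hw' := Metric.sphere_subset_closedBall hw
      have h1 : Γ * ‖w - z₀‖ ≤ Γ * D := mul_le_mul_of_nonneg_left (hD w hw') hΓpos.le
      rw [hE, norm_mul]
      refine mul_le_mul ((hHb w (h1.trans hΓD)).trans ?_) (norm_rootProd_le (hT w hw'))
        (norm_nonneg _) (by positivity)
      rw [mul_assoc 2]
      gcongr
  -- For `k = 0` this is `0` by division by zero, which is harmless because `C` is then empty.
  set ρ : ℝ := r / (17 * k) with hρ
  have hρ0 : 0 ≤ ρ := by positivity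
  have hρr : ρ ≤ r / 17 := by
    rcases Nat.eq_zero_or_pos k with h0 | h0
    · simp [hρ, h0]; positivity
    · have : (1 : ℝ) ≤ k := by exact_mod_cast h0
      rw [hρ]
      gcongr
      linarith
  have hρk : (r + ρ) ^ k ≤ 17 / 16 * r ^ k := by
    have e : r + ρ = (1 + 1 / (17 * k)) * r := by rw [hρ]; ring
    rw [e, mul_pow]
    gcongr
    refine (one_add_div_pow_le (x := 1 / 17) (by norm_num) (by positivity) ?_).trans
      (by norm_num)
    rcases Nat.eq_zero_or_pos k with h0 | h0
    · simp [h0]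
    · have : (0 : ℝ) < k := by exact_mod_cast h0
      field_simp; norm_num
  have hX : 0 < ‖h₀‖ * r ^ k := mul_pos (norm_pos_iff.2 hne) (by positivity)
  -- estimates at the midpoint
  have hEm : ∀ i, ‖normDeriv E i m‖ * r ^ i ≤ (1 / 400) / (k + 1) * (‖h₀‖ * r ^ k) := by
    intro i
    have := hcauchy m r (2 * r) (r + ρ) hr (fun w hw => ?_) (fun w hw α hα => ?_) ?_ i
    · rw [le_div_iff₀ (by positivity)] at this
      refine this.trans ?_
      have e : Γ * (2 * r) = (1 / 1000) / (k + 1) := by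
        rw [hΓ]; field_simp; norm_num
      rw [e]
      calc _ ≤ 2 * (1 / 1000 / (k + 1)) * ‖h₀‖ * (17 / 16 * r ^ k) := by gcongr
        _ = (17 / 8000) / (k + 1) * (‖h₀‖ * r ^ k) := by ring
        _ ≤ _ := mul_le_mul_of_nonneg_right
            (div_le_div_of_nonneg_right (by norm_num) (by positivity)) hX.le
    · rw [mem_closedBall_iff_norm] at hw
      have := norm_sub_le_norm_sub_add_norm_sub w m z₀
      linarith
    · rw [mem_closedBall_iff_norm] at hw
      have := norm_sub_le_norm_sub_add_norm_sub w m α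
      linarith [hroots α hα]
    · have := mul_le_mul_of_nonneg_left hkr hΓpos.le
      linarith
  have hmball : m ∈ Metric.ball z₀ (3 * r) := by
    rw [mem_ball_iff_norm]; linarith
  -- estimates on the box
  set B := Square.ofDisc m r with hB
  have hBw : B.width = 2 * r := rfl
  have hBm : ∀ ζ ∈ B.toSet, ‖ζ - m‖ ≤ 1.415 * r := by
    intro ζ hζ
    refine (Square.norm_sub_center_le hζ).trans ?_
    rw [Square.radius, hBw, div_le_iff₀ (by positivity)]
    have : (1.4141 : ℝ) ≤ √2 := Real.le_sqrt_of_sq_le (by norm_num)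
    nlinarith
  have hBball : B.toSet ⊆ Metric.ball z₀ (3 * r) := fun ζ hζ => by
    rw [mem_ball_iff_norm]
    have := norm_sub_le_norm_sub_add_norm_sub ζ m z₀
    linarith [hBm ζ hζ]
  -- Proportional to `k + 1` for two reasons: the factor `k + 2` in the error bound of the
  -- box-function is absorbed by the extra powers of `s` in Cauchy's estimate, and `(1 + 3 / (4 (k +
  -- 1)))^k` stays below 4.
  set s : ℝ := 2 * (k + 1) * r with hs
  have hs0 : 0 < s := by positivity
  have hsr : 2 * r ≤ s := by rw [hs]; linarith
  have hTk : (s + 1.5 * r) ^ k ≤ 4 * s ^ k := by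
    have e : s + 1.5 * r = (1 + (3 / 4) / (k + 1)) * s := by
      rw [hs]; field_simp; ring
    rw [e, mul_pow]
    gcongr
    refine (one_add_div_pow_le (x := 3 / 4) (by norm_num) (by positivity) ?_).trans
      (by norm_num)
    rw [mul_div_assoc', div_le_iff₀ (by positivity)]
    linarith
  have hEB : ∀ ζ ∈ B.toSet, ∀ i, ‖normDeriv E i ζ‖ ≤ 3 / 125 * ‖h₀‖ * s ^ k / s ^ i := by
    intro ζ hζ i
    have := hBm ζ hζ
    have := hcauchy ζ s (3 * s) (s + 1.5 * r) hs0 (fun w hw => ?_) (fun w hw α hα => ?_) ?_ i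
    · refine this.trans ?_
      have e : Γ * (3 * s) = 3 / 1000 := by rw [hs]; linear_combination 6 * hΓr
      rw [e]
      gcongr ?_ / _
      calc _ ≤ 2 * (3 / 1000) * ‖h₀‖ * (4 * s ^ k) := by gcongr
        _ = _ := by ring
    · rw [mem_closedBall_iff_norm] at hw
      have := norm_sub_le_norm_sub_add_norm_sub w ζ z₀
      have := norm_sub_le_norm_sub_add_norm_sub ζ m z₀
      linarith
    · rw [mem_closedBall_iff_norm] at hw
      have := norm_sub_le_norm_sub_add_norm_sub w ζ α
      have := norm_sub_le_norm_sub_add_norm_sub ζ m α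
      linarith [hroots α hα]
    · rw [hs]; linarith
  -- Beyond the degree `k` of `P` only the remainder `E` contributes.
  have hBd : ∀ ζ ∈ B.toSet, ∀ i, k < i → ‖normDeriv f i ζ‖ ≤ 3 / 125 * ‖h₀‖ * s ^ k / s ^ i := by
    intro ζ hζ i hi
    rw [hderiv ζ (hBball hζ), normDeriv_rootProd_of_card_lt hi, mul_zero, zero_add]
    exact hEB ζ hζ i
  have hmag : magnitude (A.boxFn (k + 1) B) * r ^ (k + 1) ≤ 3 / 50 * (‖h₀‖ * r ^ k) := by
    have hBw0 : 0 < B.width := by rw [hBw]; positivity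
    have := (hA.boxFn (k + 1)).magnitude_le hBw0 (hBball.trans hΩ)
      (hBd _ (Square.mem_toSet_center hBw0.le) (k + 1) (by omega))
      (fun ζ hζ => hBd ζ hζ (k + 2) (by omega))
    calc _ ≤ _ := mul_le_mul_of_nonneg_right this (by positivity)
      _ = (3 / 125 / (2 * (k + 1)) + 3 / 125 / (2 * (k + 1)) ^ 2 * (4 * (k + 2))) *
          (‖h₀‖ * r ^ k) := by
        rw [hBw, hs, pow_succ, pow_succ, pow_succ]
        push_cast
        field_simp
        ring
      _ ≤ _ := by
        refine mul_le_mul_of_nonneg_right ?_ hX.le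
        have e : (3 : ℝ) / 50 - (3 / 125 / (2 * (k + 1)) + 3 / 125 / (2 * (k + 1)) ^ 2 *
            (4 * (k + 2))) = 3 / 250 * (k * (5 * k + 7)) / (k + 1) ^ 2 := by
          field_simp; ring
        have : 0 ≤ (3 : ℝ) / 250 * (k * (5 * k + 7)) / (k + 1) ^ 2 := by positivity
        linarith
  -- the two sides of the test
  have hlhs : 399 / 400 * (‖h₀‖ * r ^ k) ≤ testLhs f k m r := by
    rw [testLhs, hderiv m hmball, normDeriv_rootProd_card, mul_one]
    have h1 := norm_sub_le (h₀ + normDeriv E k m) (normDeriv E k m)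
    rw [add_sub_cancel_right] at h1
    have h2 := mul_le_mul_of_nonneg_right h1 (pow_nonneg hr.le k)
    have h3 : (1 / 400 : ℝ) / (k + 1) * (‖h₀‖ * r ^ k) ≤ 1 / 400 * (‖h₀‖ * r ^ k) := by
      exact mul_le_mul_of_nonneg_right (div_le_self (by norm_num) hk1) hX.le
    linarith [hEm k]
  have hsum : ∑ i ∈ Finset.range k, ‖normDeriv f i m‖ * r ^ i ≤
      (1 / 16 + 1 / 400) * (‖h₀‖ * r ^ k) := by
    have h1 := sum_norm_normDeriv_rootProd_le hr.le hroots
    rw [← hk, Finset.sum_range_succ, hk, normDeriv_rootProd_card, ← hk, norm_one, one_mul] at h1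
    calc _ ≤ ∑ i ∈ Finset.range k, (‖h₀‖ * (‖normDeriv (rootProd C) i m‖ * r ^ i) +
            (1 / 400) / (k + 1) * (‖h₀‖ * r ^ k)) := by
          refine Finset.sum_le_sum fun i _ => ?_
          rw [hderiv m hmball]
          refine (mul_le_mul_of_nonneg_right (norm_add_le _ _) (by positivity)).trans ?_
          rw [add_mul, norm_mul, mul_assoc]
          exact add_le_add le_rfl (hEm i)
      _ = ‖h₀‖ * (∑ i ∈ Finset.range k, ‖normDeriv (rootProd C) i m‖ * r ^ i) +
            k * ((1 / 400) / (k + 1)) * (‖h₀‖ * r ^ k) := by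
          rw [Finset.sum_add_distrib, ← Finset.mul_sum, Finset.sum_const, Finset.card_range,
            nsmul_eq_mul, mul_assoc]
      _ ≤ ‖h₀‖ * (1 / 16 * r ^ k) + 1 / 400 * (‖h₀‖ * r ^ k) := by
          gcongr
          · linarith
          · rw [mul_div_assoc', div_le_iff₀ (by positivity)]
            linarith
      _ = _ := by ring
  -- In units of `‖h₀‖ r^k` the left side is at least `399/400` and the right side at most `1/16 +
  -- 1/400 + 3/50 = 1/8`.
  refine softCompare_positive (hA.lhsOracle k m r) (hA.rhsOracle k m r) ?_ ?_
  · exact add_nonneg (Finset.sum_nonneg fun i _ => by positivity)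
      (mul_nonneg (magnitude_nonneg _) (by positivity))
  · have : testRhs f A.boxFn k m r ≤
        (1 / 16 + 1 / 400) * (‖h₀‖ * r ^ k) + 3 / 50 * (‖h₀‖ * r ^ k) := add_le_add hsum hmag
    linarith

/-! ### Univalent functions -/

/-- With `L` the primitive of `u' / u` vanishing at `c`, the function `u exp(-L)` is constant, so
`exp(L / 2)` is the root. -/
theorem exists_differentiableOn_sq_eq {u : ℂ → ℂ} {c : ℂ} {r : ℝ} (hr : 0 < r)
    (hu : DifferentiableOn ℂ u (Metric.ball c r)) (hne : ∀ z ∈ Metric.ball c r, u z ≠ 0)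
    (hc : u c = 1) :
    ∃ s : ℂ → ℂ, DifferentiableOn ℂ s (Metric.ball c r) ∧ s c = 1 ∧
      ∀ z ∈ Metric.ball c r, s z ^ 2 = u z := by
  have hcball := Metric.mem_ball_self (x := c) hr
  have hopen := Metric.isOpen_ball (x := c) (ε := r)
  have hquot : DifferentiableOn ℂ (fun z => deriv u z / u z) (Metric.ball c r) :=
    (hu.deriv hopen).div hu hne
  obtain ⟨L, hL, hLc⟩ : ∃ L : ℂ → ℂ, (∀ z ∈ Metric.ball c r, HasDerivAt L (deriv u z / u z) z) ∧
      L c = 0 := by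
    obtain ⟨L, hL⟩ := hquot.isExactOn_ball
    exact ⟨fun z => L z - L c, fun z hz => (hL z hz).sub_const _, sub_self _⟩
  have hconst : ∀ z ∈ Metric.ball c r, u z * Complex.exp (-L z) = 1 := by
    intro z hz
    have hd : ∀ w ∈ Metric.ball c r, HasDerivAt (fun w => u w * Complex.exp (-L w)) 0 w := by
      intro w hw
      have h1 := (hu.differentiableAt (hopen.mem_nhds hw)).hasDerivAt
      have h2 := h1.mul (hL w hw).neg.cexp
      have hw0 := hne w hw
      have e : deriv u w * Complex.exp (-L w) +
          u w * (Complex.exp (-L w) * -(deriv u w / u w)) = 0 := by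
        field_simp
        ring
      exact e ▸ h2
    have := (convex_ball c r).is_const_of_fderivWithin_eq_zero (𝕜 := ℂ)
      (f := fun w => u w * Complex.exp (-L w))
      (fun w hw => (hd w hw).differentiableAt.differentiableWithinAt)
      (fun w hw => by
        rw [fderivWithin_of_isOpen hopen hw]
        ext
        simp [(hd w hw).deriv]) hz hcball
    simpa [hc, hLc] using this
  refine ⟨fun z => Complex.exp (L z / 2), fun z hz => ?_, by simp [hLc], fun z hz => ?_⟩
  · exact ((hL z hz).div_const 2).cexp.differentiableAt.differentiableWithinAt
  · rw [← Complex.exp_nat_mul]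
    have := hconst z hz
    rw [Complex.exp_neg, mul_inv_eq_one₀ (Complex.exp_ne_zero _)] at this
    rw [this]
    congr 1
    push_cast
    ring

/-- A growth estimate for univalent functions `z ↦ z q(z)` on the unit disc. -/
theorem norm_le_of_injOn_id_mul {q : ℂ → ℂ} (hq : DifferentiableOn ℂ q (Metric.ball 0 1))
    (hq0 : q 0 = 1) (hinj : InjOn (fun z => z * q z) (Metric.ball 0 1)) {w : ℂ}
    (hw : ‖w‖ = 1 / 88) : ‖q w‖ ≤ 1056 := by
  set g : ℂ → ℂ := fun z => z * q z with hg
  have hgd : DifferentiableOn ℂ g (Metric.ball 0 1) := differentiableOn_id.mul hq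
  have hg0 : g 0 = 0 := by simp [hg]
  have h0 : (0 : ℂ) ∈ Metric.ball (0 : ℂ) 1 := by simp
  have hhalf : Metric.closedBall (0 : ℂ) (1 / 2) ⊆ Metric.ball 0 1 :=
    Metric.closedBall_subset_ball (by norm_num)
  have hhalf' : Metric.ball (0 : ℂ) (1 / 2) ⊆ Metric.ball 0 1 :=
    Metric.ball_subset_closedBall.trans hhalf
  have hgz : ∀ z ∈ Metric.ball (0 : ℂ) 1, g z = 0 → z = 0 := fun z hz h =>
    hinj hz h0 (h.trans hg0.symm)
  have hqz : ∀ z ∈ Metric.ball (0 : ℂ) 1, q z ≠ 0 := by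
    intro z hz h
    have := hgz z hz (by simp [hg, h])
    rw [this, hq0] at h
    exact one_ne_zero h
  -- a point of the circle of radius `1/2` where `|g|` is minimal
  obtain ⟨z₀, hz₀, hmin⟩ := (isCompact_sphere (0 : ℂ) (1 / 2)).exists_isMinOn
    (NormedSpace.sphere_nonempty.2 (by norm_num))
    ((hgd.continuousOn.mono (Metric.sphere_subset_closedBall.trans hhalf)).norm)
  have hmin : ∀ z ∈ Metric.sphere (0 : ℂ) (1 / 2), ‖g z₀‖ ≤ ‖g z‖ := hmin
  set p := g z₀ with hp
  have hz₀n : ‖z₀‖ = 1 / 2 := by simpa using hz₀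
  have hz₀b := hhalf (Metric.sphere_subset_closedBall hz₀)
  have hp0 : p ≠ 0 := fun h => by
    have := hgz z₀ hz₀b h
    rw [this] at hz₀n
    norm_num at hz₀n
  have hpn : 0 < ‖p‖ := norm_pos_iff.2 hp0
  -- Maximum principle for `1 / q`, which equals 1 at the centre.
  have hple : ‖p‖ ≤ 1 / 2 := by
    have hd : DiffContOnCl ℂ (fun z => (q z)⁻¹) (Metric.ball 0 (1 / 2)) := by
      refine DifferentiableOn.diffContOnCl ?_
      rw [closure_ball _ (by norm_num)]
      exact (hq.mono hhalf).inv fun z hz => hqz z (hhalf hz)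
    have := Complex.norm_le_of_forall_mem_frontier_norm_le Metric.isBounded_ball hd
      (C := 1 / 2 / ‖p‖) (fun z hz => ?_) (subset_closure (Metric.mem_ball_self (by norm_num)))
    · rw [hq0, inv_one, norm_one, le_div_iff₀ hpn, one_mul] at this
      exact this
    · rw [frontier_ball _ (by norm_num)] at hz
      have h1 := hmin z hz
      have hzn : ‖z‖ = 1 / 2 := by simpa using hz
      simp only [hg, norm_mul, hzn] at h1
      rw [norm_inv, inv_le_comm₀ (norm_pos_iff.2 (hqz z (hhalf (Metric.sphere_subset_closedBall hz))))
        (by positivity), inv_div, div_le_iff₀ (by norm_num)]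
      linarith
  -- the square root of `1 - g / p`
  have hune : ∀ z ∈ Metric.ball (0 : ℂ) (1 / 2), 1 - g z / p ≠ 0 := by
    intro z hz h
    rw [sub_eq_zero, eq_comm, div_eq_one_iff_eq hp0] at h
    have := hinj (hhalf' hz) hz₀b h
    rw [mem_ball_zero_iff, this, hz₀n] at hz
    exact lt_irrefl _ hz
  obtain ⟨s, hsd, hs0, hs⟩ := exists_differentiableOn_sq_eq (u := fun z => 1 - g z / p)
    (by norm_num : (0 : ℝ) < 1 / 2) (((hgd.mono hhalf').div_const p).const_sub 1) hune
    (by simp [hg0])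
  have hsg : ∀ z ∈ Metric.ball (0 : ℂ) (1 / 2), ‖s z - 1‖ * ‖s z + 1‖ = ‖g z‖ / ‖p‖ := by
    intro z hz
    rw [← norm_mul, ← norm_div, ← norm_neg (g z / p)]
    congr 1
    linear_combination hs z hz
  -- a smaller circle, on which `|g|` is not much smaller
  obtain ⟨t, ht0, ht, htg⟩ : ∃ t : ℝ, 0 < t ∧ t < 1 / 2 ∧
      ∀ z ∈ Metric.sphere (0 : ℂ) t, ‖p‖ / 2 ≤ ‖g z‖ := by
    have hcont : ContinuousOn (fun z => ‖g z‖) (Metric.closedBall 0 (1 / 2)) :=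
      (hgd.continuousOn.mono hhalf).norm
    have hK : IsCompact (Metric.closedBall (0 : ℂ) (1 / 2) ∩ (fun z => ‖g z‖) ⁻¹' Iic (‖p‖ / 2)) :=
      (isCompact_closedBall _ _).of_isClosed_subset
        (hcont.preimage_isClosed_of_isClosed Metric.isClosed_closedBall isClosed_Iic)
        inter_subset_left
    obtain ⟨z₁, ⟨hz₁, hz₁g⟩, hmax⟩ := hK.exists_isMaxOn
      ⟨0, by simp, by simp [hg0]; positivity⟩ continuous_norm.continuousOn
    have hz₁' : ‖z₁‖ ≤ 1 / 2 := by simpa using hz₁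
    have hlt : ‖z₁‖ < 1 / 2 := by
      refine lt_of_le_of_ne hz₁' fun h => ?_
      have := hmin z₁ (by simpa using h)
      have : ‖g z₁‖ ≤ ‖p‖ / 2 := hz₁g
      linarith
    have := norm_nonneg z₁
    refine ⟨(‖z₁‖ + 1 / 2) / 2, by linarith, by linarith, fun z hz => ?_⟩
    by_contra! hlt'
    have hzn : ‖z‖ = (‖z₁‖ + 1 / 2) / 2 := by simpa using hz
    have : ‖z‖ ≤ ‖z₁‖ := hmax ⟨by rw [mem_closedBall_zero_iff]; linarith, hlt'.le⟩
    linarith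
  have htball : Metric.closedBall (0 : ℂ) t ⊆ Metric.ball 0 (1 / 2) :=
    Metric.closedBall_subset_ball ht
  -- Since `(s - 1)(s + 1) = -g / p`, having `|s - 1| < 1/5` on the circle would give `|g / p| <
  -- 11/25 < 1/2` there. So `|s - 1| ≥ 1/5` on the circle, and the quantitative open mapping theorem
  -- yields half that radius.
  have himage : Metric.ball (1 : ℂ) (1 / 10) ⊆ s '' Metric.closedBall 0 t := by
    have hd : DiffContOnCl ℂ s (Metric.ball 0 t) := by
      refine DifferentiableOn.diffContOnCl ?_
      rw [closure_ball _ ht0.ne']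
      exact hsd.mono htball
    have := hd.ball_subset_image_closedBall ht0 (ε := 1 / 5) (fun z hz => ?_) ?_
    · rw [hs0] at this
      norm_num at this ⊢
      exact this
    · rw [hs0]
      by_contra! hlt
      have h1 := hsg z (htball (Metric.sphere_subset_closedBall hz))
      have h2 : 1 / 2 ≤ ‖g z‖ / ‖p‖ := by
        rw [le_div_iff₀ hpn]
        linarith [htg z hz]
      have h3 : ‖s z + 1‖ ≤ ‖s z - 1‖ + 2 := by
        calc ‖s z + 1‖ = ‖(s z - 1) + 2‖ := by congr 1; ring
          _ ≤ ‖s z - 1‖ + ‖(2 : ℂ)‖ := norm_add_le _ _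
          _ = _ := by norm_num
      nlinarith [norm_nonneg (s z - 1), norm_nonneg (s z + 1)]
    · have hev : ∀ᶠ z in 𝓝[≠] (0 : ℂ), s z ≠ s 0 := by
        filter_upwards [self_mem_nhdsWithin,
          nhdsWithin_le_nhds (Metric.ball_mem_nhds (0 : ℂ) (by norm_num : (0 : ℝ) < 1 / 2))]
          with z hz0 hz h
        have h1 := hs z hz
        rw [h, hs0, one_pow, eq_comm, sub_eq_self, div_eq_zero_iff] at h1
        exact hz0 (hgz z (hhalf' hz) (h1.resolve_right hp0))
      exact hev.frequently.filter_mono nhdsWithin_le_nhds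
  -- Koebe's trick: `s(z) = -s(z')` gives `g(z) = g(z')`, hence `z = z'` and `s(z) = 0`, which is
  -- impossible. So `s` omits the negative of every value it takes, in particular the ball of radius
  -- `1/10` around `-1`.
  have hfar : ∀ z ∈ Metric.ball (0 : ℂ) (1 / 2), 1 / 10 ≤ ‖s z + 1‖ := by
    intro z hz
    by_contra! hlt
    obtain ⟨z', hz', h⟩ := himage (show -s z ∈ Metric.ball (1 : ℂ) (1 / 10) by
      rw [mem_ball_iff_norm, ← norm_neg, neg_sub, sub_neg_eq_add, add_comm]
      exact hlt)
    have h1 := hs z hz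
    have h2 := hs z' (htball hz')
    rw [h, neg_sq, h1] at h2
    have h3 : g z = g z' := by
      have : g z / p = g z' / p := by linear_combination -h2
      exact (div_left_inj' hp0).1 this
    have h4 := hinj (hhalf' hz) (hhalf' (htball hz')) h3
    rw [← h4] at h
    have h5 : s z = 0 := by linear_combination h / 2
    exact hune z hz (by rw [← h1, h5]; simp)
  -- Schwarz's lemma for `1 / (s + 1)`
  have hwb : w ∈ Metric.ball (0 : ℂ) (1 / 2) := by
    rw [mem_ball_zero_iff, hw]; norm_num
  have hne1 : ∀ z ∈ Metric.ball (0 : ℂ) (1 / 2), s z + 1 ≠ 0 := fun z hz h => by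
    have := hfar z hz
    rw [h] at this
    norm_num at this
  have hinv : ∀ z ∈ Metric.ball (0 : ℂ) (1 / 2), ‖(s z + 1)⁻¹‖ ≤ 10 := fun z hz => by
    rw [norm_inv, inv_le_comm₀ (norm_pos_iff.2 (hne1 z hz)) (by norm_num)]
    have := hfar z hz
    norm_num at this ⊢
    exact this
  -- The distance to the central value `1/2` is at most `10 + 1/2 ≤ 11`. At `|w| = 1/88` the lemma
  -- gives `(11 / (1/2)) / 88 = 1/4`, so `1 / (s + 1)` stays at least `1/4` in modulus.
  have hschwarz := Complex.dist_le_div_mul_dist_of_mapsTo_ball (f := fun z => (s z + 1)⁻¹)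
    (R₂ := 11) ((hsd.add_const 1).inv hne1) (fun z hz => ?_) hwb
  · rw [dist_eq_norm, dist_zero_right, hw, hs0] at hschwarz
    have h1 : ‖((1 : ℂ) + 1)⁻¹‖ = 1 / 2 := by norm_num
    have h2 : 1 / 4 ≤ ‖(s w + 1)⁻¹‖ := by
      have := norm_sub_norm_le ((1 : ℂ) + 1)⁻¹ (s w + 1)⁻¹
      rw [norm_sub_rev, h1] at this
      norm_num at hschwarz this ⊢
      linarith
    have h3 : ‖s w + 1‖ ≤ 4 := by
      rw [norm_inv, le_inv_comm₀ (by norm_num) (norm_pos_iff.2 (hne1 w hwb))] at h2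
      norm_num at h2
      exact h2
    have h4 : ‖s w - 1‖ ≤ 6 := by
      calc ‖s w - 1‖ = ‖(s w + 1) - 2‖ := by congr 1; ring
        _ ≤ ‖s w + 1‖ + ‖(2 : ℂ)‖ := norm_sub_le _ _
        _ ≤ 4 + 2 := by gcongr; norm_num
        _ = 6 := by norm_num
    have h5 : ‖g w‖ / ‖p‖ ≤ 6 * 4 := by
      rw [← hsg w hwb]
      gcongr
    rw [div_le_iff₀ hpn] at h5
    simp only [hg, norm_mul, hw] at h5
    linarith
  · rw [mem_closedBall_iff_norm]
    refine (norm_sub_le _ _).trans ?_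
    have h1 : ‖((1 : ℂ) + 1)⁻¹‖ = 1 / 2 := by norm_num
    rw [hs0, h1]
    linarith [hinv z hz]

/-- Rescaling to the unit disc, the growth estimate bounds `f` by `1056 |f(α)|` on the circle of
radius `r / 88`. As `k ≥ 1`, the factor 1056 is absorbed into a `k`-th power, and `1056 · 88 = 92928
< 10^5`. -/
theorem smaleGamma_le_of_injOn {f : ℂ → ℂ} {α : ℂ} {r : ℝ} (hr : 0 < r)
    (hf : DifferentiableOn ℂ f (Metric.ball α r)) (hα : f α ≠ 0)
    (hinj : InjOn (fun z => (z - α) * f z) (Metric.ball α r)) :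
    smaleGamma f α ≤ ENNReal.ofReal (10 ^ 5 / r) := by
  have hrC : (r : ℂ) ≠ 0 := by exact_mod_cast hr.ne'
  have hmaps : ∀ z ∈ Metric.ball (0 : ℂ) 1, α + r * z ∈ Metric.ball α r := fun z hz => by
    rw [mem_ball_zero_iff] at hz
    rw [mem_ball_iff_norm, add_sub_cancel_left, norm_mul, Complex.norm_real, Real.norm_of_nonneg hr.le]
    nlinarith
  have hbound : ∀ w ∈ Metric.sphere α (r / 88), ‖f w‖ ≤ 1056 * ‖f α‖ := by
    intro w hw
    have := norm_le_of_injOn_id_mul (q := fun z => f (α + r * z) / f α)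
      ((hf.comp (by fun_prop) hmaps).div_const _) (by simp [hα]) (fun z hz z' hz' h => ?_)
      (w := (w - α) / r) ?_
    · rw [norm_div, div_le_iff₀ (norm_pos_iff.2 hα)] at this
      rwa [mul_div_cancel₀ _ hrC, add_sub_cancel] at this
    · have := hinj (hmaps z hz) (hmaps z' hz') (by
        simp only [mul_div_assoc', div_left_inj' hα] at h
        simp only [add_sub_cancel_left, mul_assoc, h])
      exact mul_left_cancel₀ hrC (add_left_cancel this)
    · rw [norm_div, mem_sphere_iff_norm.1 hw, Complex.norm_real, Real.norm_of_nonneg hr.le]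
      field_simp
  have hd : DiffContOnCl ℂ f (Metric.ball α (r / 88)) := by
    refine DifferentiableOn.diffContOnCl (hf.mono ?_)
    rw [closure_ball _ (by positivity)]
    exact Metric.closedBall_subset_ball (by linarith)
  refine smaleGamma_le_of_norm_normDeriv_le (by positivity) hα fun k hk => ?_
  refine (norm_normDeriv_le (by positivity) hd hbound k).trans ?_
  rw [mul_comm (1056 : ℝ), mul_div_assoc]
  gcongr
  calc (1056 : ℝ) / (r / 88) ^ k ≤ 1056 ^ k / (r / 88) ^ k := by
        gcongr
        exact le_self_pow₀ (by norm_num) (by omega)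
    _ = (92928 / r) ^ k := by
        rw [← div_pow]
        congr 1
        field_simp
        norm_num
    _ ≤ (10 ^ 5 / r) ^ k := by
        gcongr
        norm_num

theorem smaleGamma_le_div_univalenceRadius {Ω : Set ℂ} {f : ℂ → ℂ} {α : ℂ}
    (hf : DifferentiableOn ℂ f Ω) (hα : f α ≠ 0) :
    smaleGamma f α ≤ 10 ^ 5 / univalenceRadius Ω f α := by
  have hconst : (10 ^ 5 : ℝ≥0∞) ≠ 0 ∧ (10 ^ 5 : ℝ≥0∞) ≠ ∞ := by
    refine ⟨by positivity, ENNReal.pow_ne_top (by norm_num)⟩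
  rw [ENNReal.le_div_iff_mul_le (.inr hconst.1) (.inr hconst.2), mul_comm,
    ← ENNReal.le_div_iff_mul_le (.inr hconst.1) (.inr hconst.2)]
  refine iSup₂_le fun r hr => ?_
  rcases eq_or_ne r 0 with rfl | hr0
  · simp
  have hrpos : 0 < (r : ℝ) := by positivity
  have h := smaleGamma_le_of_injOn hrpos (hf.mono hr.1) hα hr.2
  rw [ENNReal.ofReal_div_of_pos hrpos, ENNReal.ofReal_coe_nnreal,
    ENNReal.le_div_iff_mul_le (by simp [hr0]) (by simp)] at h
  rw [ENNReal.le_div_iff_mul_le (.inr hconst.1) (.inr hconst.2), mul_comm]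
  convert h using 1
  norm_num

/-! ### Clusters -/

/-- Cauchy's estimates on circles of a fixed radius, where `f` varies by at most a bounded factor.
-/
theorem eventually_smaleGamma_le {f : ℂ → ℂ} {z : ℂ} (hf : AnalyticAt ℂ f z) (hz : f z ≠ 0) :
    ∃ Γ : ℝ, ∀ᶠ w in 𝓝 z, smaleGamma f w ≤ ENNReal.ofReal Γ := by
  have hpos : 0 < ‖f z‖ / 2 := by positivity
  obtain ⟨s, hs, hball⟩ := Metric.eventually_nhds_iff_ball.1
    (hf.eventually_analyticAt.and (hf.continuousAt.eventually (Metric.ball_mem_nhds (f z) hpos)))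
  have hnear : ∀ w ∈ Metric.ball z s, ‖f w‖ ≤ 3 / 2 * ‖f z‖ ∧ ‖f z‖ / 2 ≤ ‖f w‖ := fun w hw => by
    have h : ‖f w - f z‖ < ‖f z‖ / 2 := by simpa [dist_eq_norm] using (hball w hw).2
    have h₁ := norm_sub_norm_le (f w) (f z)
    have h₂ := norm_sub_norm_le (f z) (f w)
    rw [norm_sub_rev] at h₂
    constructor <;> linarith
  refine ⟨12 / s, ?_⟩
  filter_upwards [Metric.ball_mem_nhds z (half_pos hs)] with w hw
  have hsub : Metric.closedBall w (s / 4) ⊆ Metric.ball z s := fun u hu => by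
    rw [Metric.mem_closedBall] at hu
    rw [Metric.mem_ball] at hw ⊢
    linarith [dist_triangle u w z]
  have hw' := (hnear w (hsub (Metric.mem_closedBall_self (by positivity)))).2
  refine smaleGamma_le_of_norm_normDeriv_le (by positivity)
    (norm_pos_iff.1 (hpos.trans_le hw')) fun k hk => ?_
  refine (norm_normDeriv_le (s := s / 4) (C := 3 * ‖f w‖) (by positivity) ?_ ?_ k).trans ?_
  · refine DifferentiableOn.diffContOnCl fun u hu => ?_
    rw [closure_ball _ (by positivity)] at hu
    exact (hball u (hsub hu)).1.differentiableAt.differentiableWithinAt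
  · intro u hu
    linarith [(hnear u (hsub (Metric.sphere_subset_closedBall hu))).1]
  · rw [mul_comm (3 : ℝ), mul_div_assoc]
    gcongr
    calc (3 : ℝ) / (s / 4) ^ k ≤ 3 ^ k / (s / 4) ^ k := by
          gcongr
          exact le_self_pow₀ (by norm_num) (by omega)
      _ = (12 / s) ^ k := by
          rw [← div_pow]
          congr 1
          field_simp
          norm_num

theorem rootProd_eq_pow_mul (C : Multiset ℂ) (z₀ w : ℂ) :
    rootProd C w = (w - z₀) ^ C.count z₀ * rootProd (C.filter (· ≠ z₀)) w := by
  induction C using Multiset.induction_on with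
  | empty => simp
  | cons α C ih =>
    rcases eq_or_ne α z₀ with rfl | h
    · rw [rootProd_cons, ih, Multiset.count_cons_self, Multiset.filter_cons_of_neg _ (by simp)]
      ring
    · rw [rootProd_cons, ih, Multiset.count_cons_of_ne h.symm, Multiset.filter_cons_of_pos (p := (· ≠ z₀)) _ h,
        rootProd_cons]
      ring

/-- Cancel the factors of `C` at `z₀` against the order of `f`; the other factors do not vanish
there. If `f` vanishes near `z₀`, then `g = 0` serves. -/
theorem exists_local_cofactor {f : ℂ → ℂ} {C : Multiset ℂ} {z₀ : ℂ} (hf : AnalyticAt ℂ f z₀)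
    (hC : C.count z₀ ≤ analyticOrderNatAt f z₀) :
    ∃ g : ℂ → ℂ, AnalyticAt ℂ g z₀ ∧ f =ᶠ[𝓝 z₀] (fun w => g w * rootProd C w) ∧
      (analyticOrderAt f z₀ ≠ ⊤ → C.count z₀ = analyticOrderNatAt f z₀ → g z₀ ≠ 0) := by
  by_cases htop : analyticOrderAt f z₀ = ⊤
  · refine ⟨fun _ => 0, analyticAt_const, ?_, fun h => absurd htop h⟩
    filter_upwards [analyticOrderAt_eq_top.1 htop] with w hw
    simpa using hw
  obtain ⟨g₀, hg₀, hne, hfg⟩ := hf.analyticOrderAt_ne_top.1 htop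
  set n := analyticOrderNatAt f z₀
  have hP : rootProd (C.filter (· ≠ z₀)) z₀ ≠ 0 := by
    simp [rootProd_eq_zero]
  have hPa := analyticAt_rootProd (C.filter (· ≠ z₀)) z₀
  refine ⟨fun w => (w - z₀) ^ (n - C.count z₀) * g₀ w / rootProd (C.filter (· ≠ z₀)) w, ?_, ?_, ?_⟩
  · exact (((analyticAt_id.sub analyticAt_const).pow _).mul hg₀).div hPa hP
  · filter_upwards [hfg, hPa.continuousAt.eventually_ne hP] with w hw hPw
    rw [hw, rootProd_eq_pow_mul C z₀ w, smul_eq_mul]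
    field_simp
    linear_combination -(g₀ w) * pow_sub_mul_pow (w - z₀) hC
  · intro _ h
    simp [h, hne, hP]

theorem cofactor_eventuallyEq {f g : ℂ → ℂ} {C : Multiset ℂ} {z₀ : ℂ} (hg : AnalyticAt ℂ g z₀)
    (hfg : f =ᶠ[𝓝 z₀] (fun w => g w * rootProd C w)) : cofactor f C =ᶠ[𝓝 z₀] g := by
  filter_upwards [hfg.eventually_nhds, hg.eventually_analyticAt] with w hw hgw
  refine Tendsto.limUnder_eq ?_
  refine (hgw.continuousAt.tendsto.mono_left nhdsWithin_le_nhds).congr' ?_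
  have hfin : {u | u ∈ C}.Finite := by
    convert C.toFinset.finite_toSet using 1
    ext; simp
  filter_upwards [nhdsWithin_le_nhds hw, self_mem_nhdsWithin, nhdsWithin_le_nhds
    ((hfin.subset sdiff_subset : ({u | u ∈ C} \ {w}).Finite).isClosed.isOpen_compl.mem_nhds
      (by simp))] with u hu huw huC
  have hP : rootProd C u ≠ 0 := by
    rw [Ne, rootProd_eq_zero]
    exact fun h => huC ⟨h, huw⟩
  change g u = f u / rootProd C u
  rw [hu, mul_div_cancel_right₀ _ hP]

theorem analyticAt_cofactor {f : ℂ → ℂ} {C : Multiset ℂ} {z₀ : ℂ} (hf : AnalyticAt ℂ f z₀)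
    (hC : C.count z₀ ≤ analyticOrderNatAt f z₀) :
    AnalyticAt ℂ (cofactor f C) z₀ ∧ f z₀ = cofactor f C z₀ * rootProd C z₀ := by
  obtain ⟨g, hg, hfg, -⟩ := exists_local_cofactor hf hC
  have h := cofactor_eventuallyEq hg hfg
  exact ⟨hg.congr h.symm, by rw [h.eq_of_nhds, hfg.eq_of_nhds]⟩

theorem cofactor_ne_zero {f : ℂ → ℂ} {C : Multiset ℂ} {z₀ : ℂ} (hf : AnalyticAt ℂ f z₀)
    (htop : analyticOrderAt f z₀ ≠ ⊤) (hC : C.count z₀ = analyticOrderNatAt f z₀) :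
    cofactor f C z₀ ≠ 0 := by
  obtain ⟨g, hg, hfg, hne⟩ := exists_local_cofactor hf hC.le
  rw [(cofactor_eventuallyEq hg hfg).eq_of_nhds]
  exact hne htop hC

theorem norm_centroid_sub_le {C : Multiset ℂ} (hC : C ≠ 0) {x : ℂ} {R : ℝ}
    (h : ∀ α ∈ C, ‖α - x‖ ≤ R) : ‖centroid C - x‖ ≤ R := by
  have hcard : 0 < (Multiset.card C : ℝ) := by
    exact_mod_cast Multiset.card_pos.2 hC
  have hcardC : (Multiset.card C : ℂ) ≠ 0 := by exact_mod_cast hcard.ne'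
  have e : centroid C - x = (C.map (fun α => α - x)).sum / (Multiset.card C : ℂ) := by
    rw [Multiset.sum_map_sub, Multiset.map_id', Multiset.map_const', Multiset.sum_replicate,
      nsmul_eq_mul, sub_div, mul_div_cancel_left₀ _ hcardC, centroid]
  rw [e, norm_div, Complex.norm_natCast, div_le_iff₀ hcard]
  refine (norm_multiset_sum_le _).trans ?_
  refine (Multiset.sum_le_card_nsmul _ R ?_).trans_eq ?_
  · simpa using h
  · simp [mul_comm]

theorem dist_centroid_le_clusterRadius {C : Multiset ℂ} {α : ℂ} (hα : α ∈ C) :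
    dist α (centroid C) ≤ clusterRadius C := by
  refine le_csInf ?_ fun r hr => hr α hα
  obtain ⟨M, hM⟩ := (C.toFinset.image fun β => dist β (centroid C)).exists_le
  exact ⟨M, fun β hβ => hM _ (Finset.mem_image_of_mem _ (Multiset.mem_toFinset.2 hβ))⟩

theorem IsRootMultiset.count_le {f : ℂ → ℂ} {D : Set ℂ} {C : Multiset ℂ}
    (h : IsRootMultiset f D C) (z : ℂ) : C.count z ≤ analyticOrderNatAt f z := by
  rw [h z]
  split_ifs <;> simp

theorem IsRootMultiset.mem {f : ℂ → ℂ} {D : Set ℂ} {C : Multiset ℂ}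
    (h : IsRootMultiset f D C) {z : ℂ} (hz : z ∈ C) : z ∈ D ∧ analyticOrderNatAt f z ≠ 0 := by
  have h1 := Multiset.count_ne_zero.2 hz
  rw [h z] at h1
  split_ifs at h1 with hD
  · exact ⟨hD, h1⟩
  · exact absurd rfl h1

theorem IsCluster.count_le {Ω : Set ℂ} {f : ℂ → ℂ} {C : Multiset ℂ} (h : IsCluster Ω f C) (z : ℂ) :
    C.count z ≤ analyticOrderNatAt f z := by
  obtain ⟨-, c, r, lam, -, -, -, hr, -⟩ := h
  exact hr.count_le z

theorem analyticOrderAt_ne_top_of_nat {f : ℂ → ℂ} {z : ℂ} (h : analyticOrderNatAt f z ≠ 0) :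
    analyticOrderAt f z ≠ ⊤ := fun h' => h (by simp [analyticOrderNatAt, h'])

/-- The centroid lies in the disc that defines the cluster, where `C` contains all roots of `f` with
full multiplicity, so the cofactor has no zero there. -/
theorem IsCluster.centroid_mem {Ω : Set ℂ} {f : ℂ → ℂ}
    (hf : DifferentiableOn ℂ f Ω) {C : Multiset ℂ} (h : IsCluster Ω f C) :
    centroid C ∈ Ω ∧ cofactor f C (centroid C) ≠ 0 := by
  obtain ⟨hC, c, r, lam, hr, hlam, hsub, hrC, -⟩ := h
  have hlt : r < lam * r := by nlinarith
  have hball : Metric.closedBall c r ⊆ Metric.ball c (lam * r) :=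
    Metric.closedBall_subset_ball hlt
  have hmem : centroid C ∈ Metric.closedBall c r := by
    rw [mem_closedBall_iff_norm]
    exact norm_centroid_sub_le hC fun α hα => mem_closedBall_iff_norm.1 (hrC.mem hα).1
  have hballΩ := Metric.ball_subset_closedBall.trans hsub
  have han : AnalyticOnNhd ℂ f (Metric.ball c (lam * r)) :=
    (hf.mono hballΩ).analyticOnNhd Metric.isOpen_ball
  obtain ⟨α, hα⟩ := Multiset.exists_mem_of_ne_zero hC
  refine ⟨hballΩ (hball hmem), cofactor_ne_zero (han _ (hball hmem)) ?_ ?_⟩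
  · exact han.analyticOrderAt_ne_top_of_isPreconnected (convex_ball _ _).isPreconnected
      (hball (hrC.mem hα).1) (hball hmem) (analyticOrderAt_ne_top_of_nat (hrC.mem hα).2)
  · rw [hrC, if_pos hmem]

theorem IsCluster.smaleGamma_cofactor_ne_top {Ω : Set ℂ} {f : ℂ → ℂ} (hΩ : IsOpen Ω)
    (hf : DifferentiableOn ℂ f Ω) {C : Multiset ℂ} (h : IsCluster Ω f C) :
    smaleGamma (cofactor f C) (centroid C) ≠ ∞ := by
  obtain ⟨hm, hne⟩ := h.centroid_mem hf
  obtain ⟨Γ, hΓ⟩ := eventually_smaleGamma_le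
    (analyticAt_cofactor (hf.analyticAt (hΩ.mem_nhds hm)) (h.count_le _)).1 hne
  exact ne_top_of_le_ne_top ENNReal.ofReal_ne_top hΓ.self_of_nhds

/-- The radius of the disc `D_C`. -/
noncomputable def discRadius (f : ℂ → ℂ) (C : Multiset ℂ) : ℝ≥0∞ :=
  sepRadius f C / (Multiset.card C : ℝ≥0∞) ^ 3

theorem IsCluster.discRadius_pos {Ω : Set ℂ} {f : ℂ → ℂ} (hΩ : IsOpen Ω)
    (hf : DifferentiableOn ℂ f Ω) {C : Multiset ℂ} (h : IsCluster Ω f C) :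
    0 < discRadius f C := by
  have hcard : (Multiset.card C : ℝ≥0∞) ≠ 0 := by
    exact_mod_cast (Multiset.card_pos.2 h.1).ne'
  refine ENNReal.div_pos (ENNReal.div_pos hcard ?_).ne' (by simp)
  exact ENNReal.mul_ne_top ENNReal.ofReal_ne_top (h.smaleGamma_cofactor_ne_top hΩ hf)

theorem StronglySeparated.edist_centroid_le {Ω : Set ℂ} {f : ℂ → ℂ} {C : Multiset ℂ}
    (h : StronglySeparated Ω f C) {α : ℂ} (hα : α ∈ C) :
    edist α (centroid C) ≤ discRadius f C / 8 := by
  have e : sepRadius f C / (8 * (Multiset.card C : ℝ≥0∞) ^ 3) = discRadius f C / 8 := by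
    rw [discRadius, div_eq_mul_inv, ENNReal.mul_inv (by norm_num) (by norm_num), mul_comm 8⁻¹,
      ← mul_assoc, ← div_eq_mul_inv, ← div_eq_mul_inv]
  rw [← e, edist_dist]
  exact (ENNReal.ofReal_le_ofReal (dist_centroid_le_clusterRadius hα)).trans h.2

theorem thirdDisc_eq (f : ℂ → ℂ) (C : Multiset ℂ) :
    thirdDisc f C = Metric.closedEBall (centroid C) (discRadius f C / 3) := rfl

theorem StronglySeparated.mem_thirdDisc {Ω : Set ℂ} {f : ℂ → ℂ} {C : Multiset ℂ}
    (h : StronglySeparated Ω f C) {α : ℂ} (hα : α ∈ C) : α ∈ thirdDisc f C :=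
  (h.edist_centroid_le hα).trans (ENNReal.div_le_div_left (by norm_num) _)

/-! ### The tests at the boxes of the tree -/

theorem c₁_bounds : 86 < c₁ ∧ c₁ < 87 := by
  have h₁ := Real.exp_one_gt_d9
  have h₂ := Real.exp_one_lt_d9
  constructor <;> rw [c₁] <;> linarith

theorem Square.radius_scale (B : Square) (s : ℝ) : (B.scale s).radius = s * B.radius := by
  simp [Square.radius, Square.scale, mul_div_assoc]

theorem Square.radius_pos {B : Square} (hB : 0 < B.width) : 0 < B.radius := by
  rw [Square.radius]; positivity

theorem firstC_ne_neg_one {A : Access} {N₀ k : ℕ} {B : Square} (hk : k ≤ N₀)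
    (h : ∀ s, (s = max 1 (c₁ * k) ∨ s = max 1 (3 * c₁ * k)) →
      SoftTest A k B.center (s * B.radius)) : firstC A N₀ B ≠ -1 := by
  have hex : ∃ k : ℕ, k ≤ N₀ ∧ SoftTestBox A k (B.scale (max 1 (c₁ * k))) ∧
      SoftTestBox A k (B.scale (max 1 (3 * c₁ * k))) := by
    refine ⟨k, hk, ?_, ?_⟩ <;> rw [SoftTestBox, Square.radius_scale]
    · exact h _ (.inl rfl)
    · exact h _ (.inr rfl)
  rw [firstC, dif_pos hex]
  omega

/-- A box at which `firstC` fails is large in terms of `γ` at each of its points. -/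
theorem lt_smaleGamma_of_firstC {Ω : Set ℂ} {f : ℂ → ℂ} {A : Access} (hA : A.Valid Ω f)
    (hf : DifferentiableOn ℂ f Ω) {N₀ : ℕ} {B : Square} (hB : 0 < B.width)
    (hΩ : Metric.ball B.center (4 * B.radius) ⊆ Ω) (h : firstC A N₀ B = -1) {z : ℂ}
    (hz : z ∈ B.toSet) (hfz : f z ≠ 0) :
    ENNReal.ofReal (1 / (2000 * B.radius)) < smaleGamma f z := by
  by_contra! hγ
  have hr := Square.radius_pos hB
  have hzc := Square.norm_sub_center_le hz
  have hsub : Metric.ball z (3 * B.radius) ⊆ Metric.ball B.center (4 * B.radius) :=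
    Metric.ball_subset_ball' (by rw [dist_eq_norm]; linarith)
  have key := softTest_of_factorization hA (m := B.center) (z₀ := z) hr 0 (by simp)
    (by rwa [norm_sub_rev]) (hsub.trans hΩ) (hf.mono (hsub.trans hΩ)) (fun w _ => by simp) hfz
    (by simpa using hγ)
  refine firstC_ne_neg_one (k := 0) (Nat.zero_le _) (fun s hs => ?_) h
  have : s = 1 := by simpa using hs
  rw [this, one_mul]
  simpa using key

/-- `firstC` succeeds at a box of suitable size that is close to a strongly separated cluster. -/
theorem firstC_ne_neg_one_of_cluster {Ω : Set ℂ} {f : ℂ → ℂ} {A : Access} (hA : A.Valid Ω f)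
    (hΩ : IsOpen Ω) (hf : DifferentiableOn ℂ f Ω) {N₀ : ℕ} {B : Square} (hB : 0 < B.width)
    {C : Multiset ℂ} (hC : IsCluster Ω f C) (hN : Multiset.card C ≤ N₀)
    (hball : Metric.ball B.center (1000 * Multiset.card C * B.radius) ⊆ Ω)
    (hroots : ∀ α ∈ C, ‖α - B.center‖ ≤ 5 * B.radius)
    (hsep : ENNReal.ofReal B.radius ≤ discRadius f C / 4) : firstC A N₀ B ≠ -1 := by
  set k := Multiset.card C with hk
  have hk0 : k ≠ 0 := (Multiset.card_pos.2 hC.1).ne'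
  have hk1 : (1 : ℝ) ≤ k := by exact_mod_cast Nat.one_le_iff_ne_zero.2 hk0
  have hR := Square.radius_pos hB
  set R := B.radius
  obtain ⟨hc, hc'⟩ := c₁_bounds
  obtain ⟨hmem, hne⟩ := hC.centroid_mem hf
  have hcen := norm_centroid_sub_le hC.1 hroots
  -- the bound for `γ`
  have hγ : smaleGamma (cofactor f C) (centroid C) ≤
      ENNReal.ofReal (1 / (4 * c₀ * k ^ 2 * R)) := by
    have hfin := hC.smaleGamma_cofactor_ne_top hΩ hf
    rcases eq_or_ne (smaleGamma (cofactor f C) (centroid C)) 0 with h0 | h0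
    · simp [h0]
    have hg := ENNReal.toReal_pos h0 hfin
    rw [discRadius, sepRadius, ← ENNReal.ofReal_toReal hfin] at hsep
    rw [← ENNReal.ofReal_toReal hfin]
    set g := (smaleGamma (cofactor f C) (centroid C)).toReal
    have hc₀ : 0 < c₀ := by unfold c₀; positivity
    have e : (k : ℝ≥0∞) / (ENNReal.ofReal c₀ * ENNReal.ofReal g) / (k : ℝ≥0∞) ^ 3 / 4 =
        ENNReal.ofReal (k / (c₀ * g) / k ^ 3 / 4) := by
      rw [ENNReal.ofReal_div_of_pos (by norm_num), ENNReal.ofReal_div_of_pos (by positivity),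
        ENNReal.ofReal_div_of_pos (by positivity), ENNReal.ofReal_mul hc₀.le,
        ENNReal.ofReal_pow (by positivity), ENNReal.ofReal_natCast]
      norm_num
    rw [← hk, e, ENNReal.ofReal_le_ofReal_iff (by positivity)] at hsep
    refine ENNReal.ofReal_le_ofReal ?_
    rw [le_div_iff₀ (by positivity)]
    have : (k : ℝ) / (c₀ * g) / k ^ 3 / 4 = 1 / (4 * c₀ * k ^ 2 * g) := by
      field_simp
    rw [this, le_div_iff₀ (by positivity)] at hsep
    linarith
  refine firstC_ne_neg_one hN fun s hs => ?_
  -- As `k ≥ 1`, the value 1 is never the maximum.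
  have hs1 : c₁ * k ≤ s ∧ s ≤ 3 * c₁ * k := by
    have h1 : 1 ≤ c₁ * k := by nlinarith
    rcases hs with rfl | rfl
    · rw [max_eq_right h1]
      constructor <;> nlinarith
    · rw [max_eq_right (by nlinarith)]
      constructor <;> nlinarith
  have hs86 : 86 * k ≤ s := by nlinarith
  have hs261 : s ≤ 261 * k := by nlinarith
  have hs0 : 0 < s := by linarith
  have hsub : Metric.ball (centroid C) (3 * (s * R)) ⊆ Ω := by
    refine (Metric.ball_subset_ball' ?_).trans hball
    rw [dist_eq_norm]
    nlinarith
  have hcount := hC.count_le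
  refine softTest_of_factorization hA (z₀ := centroid C) (h := cofactor f C) (by positivity) C
    (fun α hα => ?_) ?_ hsub ?_ ?_ hne (hγ.trans (ENNReal.ofReal_le_ofReal ?_))
  -- The roots are within `5 R` of the midpoint, and `5 · 17 = 85` is just below `c₁`.
  · rw [norm_sub_rev, le_div_iff₀ (by positivity), ← hk]
    calc _ ≤ 5 * R * (17 * k) := by gcongr; exact hroots α hα
      _ ≤ 86 * k * R := by nlinarith
      _ ≤ _ := by gcongr
  · rw [norm_sub_rev]
    refine hcen.trans ?_
    gcongr
    linarith
  · intro z hz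
    exact (analyticAt_cofactor (hf.analyticAt (hΩ.mem_nhds (hsub hz)))
      (hcount z)).1.differentiableAt.differentiableWithinAt
  · intro z hz
    exact (analyticAt_cofactor (hf.analyticAt (hΩ.mem_nhds (hsub hz))) (hcount z)).2
  -- The choice of `c₀` makes `4 c₀ = 2^9 c₁^2`, which exceeds the required `12000 c₁` since `2^9 ·
  -- 86 > 12000`.
  · have he : c₀ = 2 ^ 7 * c₁ ^ 2 := by rw [c₀, c₁]; ring
    have hc0 : 0 < c₁ := by linarith
    rw [← hk]
    refine one_div_le_one_div_of_le (by positivity) ?_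
    calc 2000 * ((k : ℝ) + 1) * (s * R) ≤ 2000 * (k + k) * (3 * c₁ * k * R) := by
          gcongr
          exact hs1.2
      _ = 12000 * (c₁ * (k ^ 2 * R)) := by ring
      _ ≤ 2 ^ 9 * c₁ * (c₁ * (k ^ 2 * R)) := by
          gcongr
          linarith
      _ = _ := by rw [he]; ring

/-! ### Geometry of squares -/

theorem Square.toSet_eq (B : Square) : B.toSet =
    Icc (B.center.re - B.width / 2) (B.center.re + B.width / 2) ×ℂ
      Icc (B.center.im - B.width / 2) (B.center.im + B.width / 2) := by
  ext z
  simp only [Square.toSet, Set.mem_ofPred_eq, Complex.mem_reProdIm, mem_Icc, abs_le]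
  constructor <;> rintro ⟨⟨h₁, h₂⟩, h₃, h₄⟩ <;> refine ⟨⟨?_, ?_⟩, ?_, ?_⟩ <;> linarith

theorem Square.isCompact_toSet (B : Square) : IsCompact B.toSet := by
  rw [Square.toSet_eq]
  exact isCompact_Icc.reProdIm isCompact_Icc

theorem Square.measurableSet_toSet (B : Square) : MeasurableSet B.toSet :=
  B.isCompact_toSet.measurableSet

theorem Square.isPreconnected_toSet (B : Square) : IsPreconnected B.toSet := by
  rw [Square.toSet_eq]
  refine Convex.isPreconnected ?_
  exact ((convex_Icc _ _).linear_preimage Complex.reLm).inter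
    ((convex_Icc _ _).linear_preimage Complex.imLm)

theorem Square.volume_toSet (B : Square) : volume B.toSet = ENNReal.ofReal B.width ^ 2 := by
  have h := Complex.volume_preserving_equiv_real_prod.measure_preimage
    ((measurableSet_Icc.prod measurableSet_Icc).nullMeasurableSet :
      NullMeasurableSet (Icc (B.center.re - B.width / 2) (B.center.re + B.width / 2) ×ˢ
        Icc (B.center.im - B.width / 2) (B.center.im + B.width / 2)) volume)
  have e : Complex.measurableEquivRealProd ⁻¹'
      (Icc (B.center.re - B.width / 2) (B.center.re + B.width / 2) ×ˢ
        Icc (B.center.im - B.width / 2) (B.center.im + B.width / 2)) = B.toSet := by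
    rw [Square.toSet_eq]; rfl
  rw [e] at h
  rw [h, Measure.volume_eq_prod, Measure.prod_prod, Real.volume_Icc, Real.volume_Icc, sq]
  congr 2 <;> ring

theorem Square.toSet_subset_scale {B : Square} (hB : 0 ≤ B.width) {s : ℝ} (hs : 1 ≤ s) :
    B.toSet ⊆ (B.scale s).toSet := by
  rintro z ⟨h₁, h₂⟩
  have : B.width ≤ s * B.width := by nlinarith
  exact ⟨h₁.trans (by simp only [Square.scale]; linarith),
    h₂.trans (by simp only [Square.scale]; linarith)⟩

theorem Square.ball_subset_scale {B : Square} {c : ℂ} (hc : c ∈ B.toSet) {R s : ℝ}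
    (h : B.width / 2 + R ≤ s * B.width / 2) : Metric.ball c R ⊆ (B.scale s).toSet := by
  intro z hz
  rw [mem_ball_iff_norm] at hz
  have h₁ := (Complex.abs_re_le_norm (z - c)).trans hz.le
  have h₂ := (Complex.abs_im_le_norm (z - c)).trans hz.le
  rw [Complex.sub_re] at h₁
  rw [Complex.sub_im] at h₂
  have h₃ := abs_sub_le z.re c.re B.center.re
  have h₄ := abs_sub_le z.im c.im B.center.im
  exact ⟨by simp only [Square.scale]; linarith [hc.1], by simp only [Square.scale]; linarith [hc.2]⟩

theorem Square.radius_le_width {B : Square} (hB : 0 ≤ B.width) : B.radius ≤ B.width := by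
  rw [Square.radius]
  exact div_le_self hB (Real.one_le_sqrt.2 (by norm_num))

theorem Square.two_mul_radius_sq (B : Square) : 2 * B.radius ^ 2 = B.width ^ 2 := by
  rw [Square.radius, div_pow, Real.sq_sqrt (by norm_num)]
  ring

theorem Square.child_subset {B B' : Square} (h : B' ∈ B.children) : B'.toSet ⊆ B.toSet := by
  obtain ⟨hw, hre, him⟩ := h
  rintro z ⟨h₁, h₂⟩
  rw [hw] at h₁ h₂
  rw [abs_le] at h₁ h₂
  refine ⟨abs_le.2 ?_, abs_le.2 ?_⟩
  · rcases hre with h | h <;> rw [h] at h₁ <;> constructor <;> linarith [h₁.1, h₁.2]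
  · rcases him with h | h <;> rw [h] at h₂ <;> constructor <;> linarith [h₂.1, h₂.2]

theorem InTree.geometry {A : Access} {N₀ : ℕ} {B₀ B : Square} (h : InTree A N₀ B₀ B)
    (hB₀ : 0 < B₀.width) : 0 < B.width ∧ B.width ≤ B₀.width ∧ B.toSet ⊆ B₀.toSet := by
  induction h with
  | root => exact ⟨hB₀, le_rfl, Subset.rfl⟩
  | child _ _ hc ih =>
    obtain ⟨h₁, h₂, h₃⟩ := ih
    rw [hc.1]
    exact ⟨by linarith, by linarith, (Square.child_subset hc).trans h₃⟩

/-! ### Roots and maximal clusters -/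

/-- The hypotheses of the main theorem on the input of the algorithm. -/
structure Admissible (Ω : Set ℂ) (f : ℂ → ℂ) (B₀ : Square) (N₀ : ℕ) (A : Access) : Prop where
  isOpen : IsOpen Ω
  differentiableOn : DifferentiableOn ℂ f Ω
  width_pos : 0 < B₀.width
  subset : (B₀.scale (10000 * (N₀ + 1))).toSet ⊆ Ω
  exists_ne : ∃ z ∈ B₀.toSet, f z ≠ 0
  valid : A.Valid Ω f
  card_le : ∀ C ∈ maximalClusters Ω f B₀, Multiset.card C ≤ N₀

theorem strong_of_mem_maximalClusters {Ω : Set ℂ} {f : ℂ → ℂ} {B₀ : Square} {C : Multiset ℂ}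
    (hC : C ∈ maximalClusters Ω f B₀) :
    StronglySeparated Ω f C ∧ ∀ α ∈ C, α ∈ (B₀.scale 2).toSet :=
  (show Maximal (fun C' => StronglySeparated Ω f C' ∧ ∀ α ∈ C', α ∈ (B₀.scale 2).toSet) C
    from hC).prop

namespace Admissible

variable {Ω : Set ℂ} {f : ℂ → ℂ} {B₀ : Square} {N₀ : ℕ} {A : Access}

theorem ball_subset (h : Admissible Ω f B₀ N₀ A) {c : ℂ} (hc : c ∈ B₀.toSet) {R : ℝ}
    (hR : R ≤ 1000 * (N₀ + 1) * B₀.width) : Metric.ball c R ⊆ Ω := by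
  refine (Square.ball_subset_scale hc ?_).trans h.subset
  have := h.width_pos
  have : 0 ≤ (N₀ : ℝ) * B₀.width := by positivity
  linarith

theorem two_subset (h : Admissible Ω f B₀ N₀ A) : (B₀.scale 2).toSet ⊆
    (B₀.scale (10000 * (N₀ + 1))).toSet := by
  have hw := h.width_pos
  have hN : (0 : ℝ) ≤ N₀ := by positivity
  have e : B₀.scale (10000 * (N₀ + 1)) = (B₀.scale 2).scale (5000 * (N₀ + 1)) := by
    simp only [Square.scale, Square.mk.injEq, true_and]; ring
  rw [e]
  exact Square.toSet_subset_scale (by simp only [Square.scale]; positivity) (by linarith)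

theorem toSet_subset_two (h : Admissible Ω f B₀ N₀ A) : B₀.toSet ⊆ (B₀.scale 2).toSet :=
  Square.toSet_subset_scale h.width_pos.le (by norm_num)

theorem analyticAt (h : Admissible Ω f B₀ N₀ A) {z : ℂ} (hz : z ∈ Ω) : AnalyticAt ℂ f z :=
  h.differentiableOn.analyticAt (h.isOpen.mem_nhds hz)

theorem order_ne_top (h : Admissible Ω f B₀ N₀ A) {z : ℂ} (hz : z ∈ (B₀.scale 2).toSet) :
    analyticOrderAt f z ≠ ⊤ := by
  obtain ⟨w, hw, hne⟩ := h.exists_ne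
  have han : AnalyticOnNhd ℂ f (B₀.scale (10000 * (N₀ + 1))).toSet := fun z hz =>
    h.analyticAt (h.subset hz)
  have hw' := h.two_subset (h.toSet_subset_two hw)
  refine han.analyticOrderAt_ne_top_of_isPreconnected (Square.isPreconnected_toSet _) hw'
    (h.two_subset hz) ?_
  rw [(han w hw').analyticOrderAt_eq_zero.2 hne]
  simp

theorem eventually_ne_zero (h : Admissible Ω f B₀ N₀ A) {z : ℂ} (hz : z ∈ (B₀.scale 2).toSet) :
    ∀ᶠ w in 𝓝[≠] z, f w ≠ 0 := by
  have han := h.analyticAt (h.subset (h.two_subset hz))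
  exact han.eventually_eq_zero_or_eventually_ne_zero.resolve_left fun h' =>
    h.order_ne_top hz (analyticOrderAt_eq_top.2 h')

theorem finite_roots (h : Admissible Ω f B₀ N₀ A) :
    {z | z ∈ (B₀.scale 2).toSet ∧ f z = 0}.Finite := by
  by_contra hinf
  obtain ⟨z, hz, hacc⟩ := Set.Infinite.exists_accPt_of_subset_isCompact hinf
    (B₀.scale 2).isCompact_toSet fun _ hw => hw.1
  rw [accPt_iff_frequently_nhdsNE] at hacc
  obtain ⟨w, hw, hw'⟩ := (hacc.and_eventually (h.eventually_ne_zero hz)).exists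
  exact hw' hw.2

/-- All these clusters are submultisets of the finite multiset `T` of roots in `2 B₀`. -/
theorem finite_clusters (h : Admissible Ω f B₀ N₀ A) :
    {C | StronglySeparated Ω f C ∧ ∀ α ∈ C, α ∈ (B₀.scale 2).toSet}.Finite := by
  set S := h.finite_roots.toFinset with hS
  set T : Multiset ℂ := ∑ a ∈ S, Multiset.replicate (analyticOrderNatAt f a) a
  refine (Set.finite_Iic T).subset ?_
  rintro C ⟨hC, hmem⟩
  rw [mem_Iic, Multiset.le_iff_count]
  intro z
  by_cases hz : z ∈ C
  · have hord := hC.1.count_le z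
    have hne : analyticOrderNatAt f z ≠ 0 := by
      have := Multiset.count_pos.2 hz
      omega
    have hzS : z ∈ S := by
      rw [hS, Set.Finite.mem_toFinset]
      exact ⟨hmem z hz, apply_eq_zero_of_analyticOrderNatAt_ne_zero hne⟩
    refine hord.trans ?_
    rw [Multiset.count_sum']
    refine le_trans ?_ (Finset.single_le_sum (fun _ _ => Nat.zero_le _) hzS)
    simp
  · rw [Multiset.count_eq_zero_of_notMem hz]
    exact Nat.zero_le _

theorem finite_maximalClusters (h : Admissible Ω f B₀ N₀ A) :
    (maximalClusters Ω f B₀).Finite :=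
  h.finite_clusters.subset fun _ hC => strong_of_mem_maximalClusters hC

/-- Roots are isolated, and a single root taken with its full multiplicity has cluster radius 0.
Hence every root in `B₀` lies in some maximal cluster. -/
theorem stronglySeparated_replicate (h : Admissible Ω f B₀ N₀ A) {α : ℂ}
    (hα : α ∈ (B₀.scale 2).toSet) (hfα : f α = 0) :
    StronglySeparated Ω f (Multiset.replicate (analyticOrderNatAt f α) α) := by
  have hαΩ := h.subset (h.two_subset hα)
  have han := h.analyticAt hαΩ
  have hn : analyticOrderNatAt f α ≠ 0 := by
    intro h0
    have := Nat.cast_analyticOrderNatAt (h.order_ne_top hα)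
    rw [h0] at this
    exact han.analyticOrderAt_ne_zero.2 hfα this.symm
  set C := Multiset.replicate (analyticOrderNatAt f α) α with hC
  have hC0 : C ≠ 0 := by
    rw [hC, Ne, ← Multiset.card_eq_zero, Multiset.card_replicate]
    exact hn
  have hmem : ∀ β ∈ C, β = α := fun β hβ => Multiset.eq_of_mem_replicate hβ
  refine ⟨⟨hC0, ?_⟩, ?_⟩
  · obtain ⟨ε, hε, hball⟩ := Metric.eventually_nhds_iff_ball.1
      ((h.isOpen.eventually_mem hαΩ).and (eventually_nhdsWithin_iff.1 (h.eventually_ne_zero hα)))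
    have hroot : ∀ s, 0 ≤ s → s < ε → IsRootMultiset f (Metric.closedBall α s) C := by
      intro s hs0 hs z
      rw [hC, Multiset.count_replicate]
      by_cases hz : z ∈ Metric.closedBall α s
      · rw [if_pos hz]
        split_ifs with hzα
        · rw [hzα]
        · have hfz := (hball z (Metric.closedBall_subset_ball hs hz)).2 (Ne.symm hzα)
          by_contra h0
          exact hfz (apply_eq_zero_of_analyticOrderNatAt_ne_zero (Ne.symm h0))
      · rw [if_neg hz, if_neg]
        rintro rfl
        exact hz (Metric.mem_closedBall_self hs0)
    refine ⟨α, ε / 3, 2, by positivity, by norm_num, fun z hz => ?_,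
      hroot _ (by positivity) (by linarith), hroot _ (by positivity) (by linarith)⟩
    exact (hball z (Metric.closedBall_subset_ball (by linarith) hz)).1
  · have hcen : centroid C = α := by
      have := norm_centroid_sub_le (R := 0) hC0 (x := α) fun β hβ => by simp [hmem β hβ]
      exact sub_eq_zero.1 (norm_le_zero_iff.1 this)
    have hle : clusterRadius C ≤ 0 := by
      refine csInf_le ⟨0, fun r hr => ?_⟩ fun β hβ => ?_
      · obtain ⟨β, hβ⟩ := Multiset.exists_mem_of_ne_zero hC0
        exact dist_nonneg.trans (hr β hβ)
      · rw [hcen, hmem β hβ, dist_self]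
    rw [ENNReal.ofReal_of_nonpos hle]
    exact zero_le

theorem exists_maximalCluster (h : Admissible Ω f B₀ N₀ A) {α : ℂ}
    (hα : α ∈ B₀.toSet) (hfα : f α = 0) : ∃ C ∈ maximalClusters Ω f B₀, α ∈ C := by
  have hα2 := h.toSet_subset_two hα
  have hs := h.stronglySeparated_replicate hα2 hfα
  obtain ⟨C, hle, hC⟩ := h.finite_clusters.exists_le_maximal
    (a := Multiset.replicate (analyticOrderNatAt f α) α)
    ⟨hs, fun β hβ => by rwa [Multiset.eq_of_mem_replicate hβ]⟩
  refine ⟨C, hC, Multiset.mem_of_le hle ?_⟩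
  obtain ⟨β, hβ⟩ := Multiset.exists_mem_of_ne_zero hs.1.1
  have := Multiset.eq_of_mem_replicate hβ
  rwa [this] at hβ

theorem ne_zero_of_mem_exclusionRegion (h : Admissible Ω f B₀ N₀ A) {z : ℂ}
    (hz : z ∈ exclusionRegion Ω f B₀) : f z ≠ 0 := fun h0 => by
  obtain ⟨C, hC, hzC⟩ := h.exists_maximalCluster hz.1 h0
  exact hz.2 (mem_biUnion hC ((strong_of_mem_maximalClusters hC).1.mem_thirdDisc hzC))

theorem measurableSet_exclusionRegion (h : Admissible Ω f B₀ N₀ A) :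
    MeasurableSet (exclusionRegion Ω f B₀) :=
  B₀.measurableSet_toSet.diff (h.finite_maximalClusters.measurableSet_biUnion fun _ _ =>
    Metric.isClosed_closedEBall.measurableSet)

/-! ### The internal nodes of the tree -/

theorem lt_smaleGamma (h : Admissible Ω f B₀ N₀ A) {B : Square} (hB : InTree A N₀ B₀ B)
    (hfirst : firstC A N₀ B = -1) {z : ℂ} (hz : z ∈ B.toSet) (hfz : f z ≠ 0) :
    ENNReal.ofReal (1 / (2000 * B.radius)) < smaleGamma f z := by
  obtain ⟨hw, hle, hsub⟩ := hB.geometry h.width_pos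
  refine lt_smaleGamma_of_firstC h.valid h.differentiableOn hw ?_ hfirst hz hfz
  refine h.ball_subset (hsub (Square.mem_toSet_center hw.le)) ?_
  have := Square.radius_le_width hw.le
  have : 0 ≤ (N₀ : ℝ) * B₀.width := mul_nonneg (by positivity) h.width_pos.le
  linarith

theorem discRadius_lt_of_roots (h : Admissible Ω f B₀ N₀ A) {C : Multiset ℂ}
    (hC : C ∈ maximalClusters Ω f B₀) {B : Square} (hB : InTree A N₀ B₀ B)
    (hfirst : firstC A N₀ B = -1) (hroots : ∀ α ∈ C, ‖α - B.center‖ ≤ 5 * B.radius) :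
    discRadius f C / 4 < ENNReal.ofReal B.radius := by
  by_contra! hle
  have hgeo := hB.geometry h.width_pos
  have hN := h.card_le C hC
  refine firstC_ne_neg_one_of_cluster h.valid h.isOpen h.differentiableOn hgeo.1
    (strong_of_mem_maximalClusters hC).1.1 hN
    (h.ball_subset (hgeo.2.2 (Square.mem_toSet_center hgeo.1.le)) ?_) hroots hle hfirst
  have h₁ := (Square.radius_le_width hgeo.1.le).trans hgeo.2.1
  have h₂ : (Multiset.card C : ℝ) ≤ N₀ + 1 := by
    have : (Multiset.card C : ℝ) ≤ N₀ := by exact_mod_cast hN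
    linarith
  have := (Square.radius_pos hgeo.1).le
  gcongr

/-- By `discRadius_lt_of_roots` it is enough that `C` lies within `5 r_B` of the midpoint. For the
root box this follows from `C ⊆ 2 B₀`. Otherwise the parent also contains `z` and failed, so by
induction its radius `2 r_B` exceeds `ρ / 4`, where `ρ` is the radius of `D_C`. The distance from a
root to `z` is then at most `ρ / 8 + ρ / 3 < (11/3) r_B`, and `z` is within `r_B` of the midpoint.
-/
theorem discRadius_lt (h : Admissible Ω f B₀ N₀ A) {C : Multiset ℂ}
    (hC : C ∈ maximalClusters Ω f B₀) {B : Square} (hB : InTree A N₀ B₀ B)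
    (hfirst : firstC A N₀ B = -1) {z : ℂ} (hz : z ∈ B.toSet) (hzC : z ∈ thirdDisc f C) :
    discRadius f C / 4 < ENNReal.ofReal B.radius := by
  obtain ⟨hstrong, hmem⟩ := strong_of_mem_maximalClusters hC
  induction hB with
  | root =>
    refine h.discRadius_lt_of_roots hC .root hfirst fun α hα => ?_
    have h₁ := Square.norm_sub_center_le (hmem α hα)
    have h₂ := (Square.radius_pos h.width_pos).le
    rw [Square.radius_scale] at h₁
    exact h₁.trans (by linarith)
  | @child P B hP hPfirst hc ih =>
    have hlt := ih hPfirst (Square.child_subset hc hz)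
    have hBtree := InTree.child hP hPfirst hc
    refine h.discRadius_lt_of_roots hC hBtree hfirst fun α hα => ?_
    have hrad : P.radius = 2 * B.radius := by
      rw [Square.radius, Square.radius, hc.1]; ring
    have hBr := Square.radius_pos (hBtree.geometry h.width_pos).1
    have hne : discRadius f C ≠ ∞ := by
      intro h0
      rw [h0, ENNReal.top_div_of_ne_top (by norm_num)] at hlt
      exact not_top_lt hlt
    have hd := hstrong.edist_centroid_le hα
    rw [thirdDisc_eq, Metric.mem_closedEBall] at hzC
    rw [← ENNReal.ofReal_toReal hne] at hlt hd hzC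
    set ρ := (discRadius f C).toReal
    have hρ : 0 ≤ ρ := ENNReal.toReal_nonneg
    have e : ∀ n : ℕ, n ≠ 0 → ENNReal.ofReal ρ / n = ENNReal.ofReal (ρ / n) := fun n hn => by
      rw [ENNReal.ofReal_div_of_pos (by positivity), ENNReal.ofReal_natCast]
    have e4 := e 4 (by norm_num)
    have e8 := e 8 (by norm_num)
    have e3 := e 3 (by norm_num)
    norm_num at e4 e8 e3
    rw [e4, ENNReal.ofReal_lt_ofReal_iff (by linarith), hrad] at hlt
    rw [e8, edist_dist, ENNReal.ofReal_le_ofReal_iff (by positivity)] at hd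
    rw [e3, edist_dist, ENNReal.ofReal_le_ofReal_iff (by positivity)] at hzC
    have h₁ := Square.norm_sub_center_le hz
    rw [← dist_eq_norm] at h₁ ⊢
    linarith [dist_triangle α z B.center, dist_triangle_right α z (centroid C)]

end Admissible

/-! ### The boxes of one level -/

/-- The box with indices `(n, i, j)` in the infinite subdivision of `B₀`. -/
noncomputable def gridBox (B₀ : Square) (x : ℕ × ℕ × ℕ) : Square :=
  ⟨⟨B₀.center.re - B₀.width / 2 + (x.2.1 + 1 / 2) * (B₀.width / 2 ^ x.1),
    B₀.center.im - B₀.width / 2 + (x.2.2 + 1 / 2) * (B₀.width / 2 ^ x.1)⟩, B₀.width / 2 ^ x.1⟩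

theorem InTree.exists_gridBox {A : Access} {N₀ : ℕ} {B₀ B : Square} (h : InTree A N₀ B₀ B) :
    ∃ x : ℕ × ℕ × ℕ, x.2.1 < 2 ^ x.1 ∧ x.2.2 < 2 ^ x.1 ∧ B = gridBox B₀ x := by
  induction h with
  | root =>
    refine ⟨(0, 0, 0), by simp, by simp, ?_⟩
    apply Square.ext
    · apply Complex.ext <;> simp [gridBox] <;> ring
    · simp [gridBox]
  | child _ _ hc ih =>
    obtain ⟨⟨n, i, j⟩, hi, hj, rfl⟩ := ih
    obtain ⟨hw, hre, him⟩ := hc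
    have aux : ∀ (b c w : ℝ) (i : ℕ), i < 2 ^ n →
        (c = b + (i + 1 / 2) * (w / 2 ^ n) - w / 2 ^ n / 4 ∨
          c = b + (i + 1 / 2) * (w / 2 ^ n) + w / 2 ^ n / 4) →
        ∃ i' < 2 ^ (n + 1), c = b + ((i' : ℕ) + 1 / 2) * (w / 2 ^ (n + 1)) := by
      rintro b c w i hi (rfl | rfl)
      · refine ⟨2 * i, by omega, ?_⟩
        push_cast
        ring
      · refine ⟨2 * i + 1, by omega, ?_⟩
        push_cast
        ring
    obtain ⟨i', hi', hre'⟩ := aux _ _ _ i hi hre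
    obtain ⟨j', hj', him'⟩ := aux _ _ _ j hj him
    refine ⟨(n + 1, i', j'), hi', hj', ?_⟩
    apply Square.ext
    · exact Complex.ext hre' him'
    · rw [hw]
      simp only [gridBox]
      ring

theorem encard_strip_le (b x u : ℝ) (hu : 0 < u) :
    {i : ℕ | |x - (b + (i + 1 / 2) * u)| ≤ u / 2}.encard ≤ 2 := by
  -- The intervals are closed, so a common endpoint belongs to two of them.
  refine (Set.encard_le_encard (t := {⌊(x - b) / u⌋₊, ⌊(x - b) / u⌋₊ - 1}) ?_).trans
    ((Set.encard_insert_le _ _).trans (by rw [Set.encard_singleton]; norm_num))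
  intro i hi
  have hi' : |x - (b + (i + 1 / 2) * u)| ≤ u / 2 := hi
  rw [abs_le] at hi'
  have h₁ : (i : ℝ) ≤ (x - b) / u := by
    rw [le_div_iff₀ hu]; linarith [hi'.1]
  have h₂ : (x - b) / u ≤ i + 1 := by
    rw [div_le_iff₀ hu]; linarith [hi'.2]
  have h₃ := Nat.le_floor h₁
  have h₄ : ⌊(x - b) / u⌋₊ ≤ i + 1 := by
    have := Nat.floor_le_floor h₂
    rwa [← Nat.cast_add_one, Nat.floor_natCast] at this
  simp only [mem_insert_iff, mem_singleton_iff]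
  omega

theorem tsum_indicator_one_eq {α : Type*} (s : Set α) :
    ∑' i, s.indicator (1 : α → ℝ≥0∞) i = s.encard := by
  rw [← ENNReal.tsum_set_one]
  exact (tsum_subtype s (fun _ => (1 : ℝ≥0∞))).symm

/-- A point lies in at most four boxes of each level. -/
theorem tsum_gridBox_indicator_le {B₀ : Square} (hB₀ : 0 < B₀.width) (n : ℕ) (z : ℂ) :
    ∑' y : ℕ × ℕ, (gridBox B₀ (n, y)).toSet.indicator (1 : ℂ → ℝ≥0∞) z ≤ 4 := by
  set u := B₀.width / 2 ^ n
  set s : ℝ → ℝ → Set ℕ := fun b x => {i : ℕ | |x - (b + (i + 1 / 2) * u)| ≤ u / 2}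
  set bx := B₀.center.re - B₀.width / 2
  set bz := B₀.center.im - B₀.width / 2
  have hs : ∀ b x, ∑' i, (s b x).indicator (1 : ℕ → ℝ≥0∞) i ≤ 2 := fun b x => by
    rw [tsum_indicator_one_eq]
    exact_mod_cast ENat.toENNReal_le.2 (encard_strip_le b x u (by positivity))
  have e : ∀ y : ℕ × ℕ, (gridBox B₀ (n, y)).toSet.indicator (1 : ℂ → ℝ≥0∞) z =
      (s bx z.re).indicator 1 y.1 * (s bz z.im).indicator 1 y.2 := by
    intro y
    classical
    by_cases h₁ : y.1 ∈ s bx z.re <;> by_cases h₂ : y.2 ∈ s bz z.im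
    · rw [indicator_of_mem h₁, indicator_of_mem h₂, indicator_of_mem]
      · simp
      · exact ⟨h₁, h₂⟩
    all_goals
      rw [indicator_of_notMem (show z ∉ (gridBox B₀ (n, y)).toSet from fun h => by
        first | exact h₁ h.1 | exact h₂ h.2)]
      simp [h₁, h₂]
  simp_rw [e]
  rw [ENNReal.tsum_prod']
  simp_rw [ENNReal.tsum_mul_left, ENNReal.tsum_mul_right]
  calc _ ≤ (2 : ℝ≥0∞) * 2 := mul_le_mul' (hs _ _) (hs _ _)
    _ = 4 := by norm_num

theorem tsum_four_pow_le (a Y : ℝ≥0∞) (s : Set ℕ) (h : ∀ n ∈ s, 4 ^ n * a ≤ Y) :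
    ∑' n, s.indicator (fun n => 4 ^ n * a) n ≤ 2 * Y := by
  refine ENNReal.tsum_le_of_sum_range_le fun N => ?_
  -- A geometric sum is dominated by its last term; the first bound makes the induction for the
  -- second one work.
  suffices ∑ n ∈ Finset.range N, s.indicator (fun n => 4 ^ n * a) n ≤ 4 ^ N * a ∧
      ∑ n ∈ Finset.range N, s.indicator (fun n => 4 ^ n * a) n ≤ 2 * Y from this.2
  induction N with
  | zero => simp
  | succ N ih =>
    rw [Finset.sum_range_succ]
    by_cases hN : N ∈ s
    · rw [indicator_of_mem hN]
      have h₁ : ∑ n ∈ Finset.range N, s.indicator (fun n => 4 ^ n * a) n + 4 ^ N * a ≤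
          2 * (4 ^ N * a) := by
        rw [two_mul]
        gcongr
        exact ih.1
      refine ⟨h₁.trans ?_, h₁.trans (by gcongr; exact h N hN)⟩
      rw [pow_succ, mul_comm (4 ^ N) 4, mul_assoc]
      gcongr
      norm_num
    · rw [indicator_of_notMem hN, add_zero]
      refine ⟨ih.1.trans ?_, ih.2⟩
      gcongr <;> norm_num

theorem gridBox_width (B₀ : Square) (x : ℕ × ℕ × ℕ) :
    (gridBox B₀ x).width = B₀.width / 2 ^ x.1 := rfl

theorem inv_volume_gridBox (B₀ : Square) (x : ℕ × ℕ × ℕ) :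
    4 ^ x.1 * (ENNReal.ofReal B₀.width ^ 2)⁻¹ = (volume (gridBox B₀ x).toSet)⁻¹ := by
  rw [Square.volume_toSet, gridBox_width, ENNReal.ofReal_div_of_pos (by positivity),
    ENNReal.ofReal_pow (by norm_num), div_eq_mul_inv, mul_pow,
    ENNReal.mul_inv (.inr (by simp)) (.inr (by simp)), ← ENNReal.inv_pow, inv_inv, mul_comm,
    ← pow_mul, mul_comm x.1 2, pow_mul]
  norm_num

/-- The sum of `1 / |B|` over a set of boxes `B` that contain a given point. -/
theorem tsum_inv_volume_le {B₀ : Square} (hB₀ : 0 < B₀.width) (J : Set (ℕ × ℕ × ℕ)) (z : ℂ)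
    (Y : ℝ≥0∞) (h : ∀ x ∈ J, z ∈ (gridBox B₀ x).toSet → (volume (gridBox B₀ x).toSet)⁻¹ ≤ Y) :
    ∑' x : J, (gridBox B₀ x).toSet.indicator (fun _ => (volume (gridBox B₀ x).toSet)⁻¹) z ≤
      8 * Y := by
  set a := (ENNReal.ofReal B₀.width ^ 2)⁻¹ with ha
  -- The levels that matter at `z`. All boxes of level `n` have the same inverse area `4^n a`, so
  -- the constant 8 is 4 boxes per level times 2 from the geometric sum.
  set s : Set ℕ := {n | ∃ y, (n, y) ∈ J ∧ z ∈ (gridBox B₀ (n, y)).toSet}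
  have hle : ∀ n ∈ s, 4 ^ n * a ≤ Y := by
    rintro n ⟨y, hy, hz⟩
    have := h _ hy hz
    rwa [← inv_volume_gridBox B₀] at this
  have hterm : ∀ x : ℕ × ℕ × ℕ, J.indicator (fun x => (gridBox B₀ x).toSet.indicator
        (fun _ => (volume (gridBox B₀ x).toSet)⁻¹) z) x ≤
      s.indicator (fun n => 4 ^ n * a) x.1 * (gridBox B₀ x).toSet.indicator (1 : ℂ → ℝ≥0∞) z := by
    intro x
    by_cases hx : x ∈ J
    · by_cases hz : z ∈ (gridBox B₀ x).toSet
      · rw [indicator_of_mem hx, indicator_of_mem hz, indicator_of_mem hz,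
          indicator_of_mem (show x.1 ∈ s from ⟨x.2, hx, hz⟩), ← inv_volume_gridBox B₀]
        simp [ha]
      · rw [indicator_of_mem hx, indicator_of_notMem hz]
        exact zero_le
    · rw [indicator_of_notMem hx]
      exact zero_le
  calc _ = ∑' x, J.indicator (fun x => (gridBox B₀ x).toSet.indicator
        (fun _ => (volume (gridBox B₀ x).toSet)⁻¹) z) x := tsum_subtype J (fun x =>
          (gridBox B₀ x).toSet.indicator (fun _ => (volume (gridBox B₀ x).toSet)⁻¹) z)
    _ ≤ ∑' x : ℕ × ℕ × ℕ, s.indicator (fun n => 4 ^ n * a) x.1 *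
        (gridBox B₀ x).toSet.indicator (1 : ℂ → ℝ≥0∞) z := ENNReal.tsum_le_tsum hterm
    _ = ∑' n, s.indicator (fun n => 4 ^ n * a) n *
        ∑' y : ℕ × ℕ, (gridBox B₀ (n, y)).toSet.indicator (1 : ℂ → ℝ≥0∞) z := by
      rw [ENNReal.tsum_prod']
      simp_rw [ENNReal.tsum_mul_left]
    _ ≤ ∑' n, s.indicator (fun n => 4 ^ n * a) n * 4 := by
      gcongr with n
      exact tsum_gridBox_indicator_le hB₀ n z
    _ ≤ 2 * Y * 4 := by
      rw [ENNReal.tsum_mul_right]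
      gcongr
      exact tsum_four_pow_le a Y s hle
    _ = 8 * Y := by
      rw [mul_right_comm]; norm_num

/-- The number of boxes in terms of an integral. -/
theorem encard_eq_lintegral {B₀ : Square} (hB₀ : 0 < B₀.width) (J : Set (ℕ × ℕ × ℕ))
    (hJ : ∀ x ∈ J, (gridBox B₀ x).toSet ⊆ B₀.toSet) :
    (J.encard : ℝ≥0∞) = ∫⁻ z in B₀.toSet, ∑' x : J,
      (gridBox B₀ x).toSet.indicator (fun _ => (volume (gridBox B₀ x).toSet)⁻¹) z := by
  rw [lintegral_tsum fun x => (measurable_const.indicator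
    (Square.measurableSet_toSet _)).aemeasurable, ← ENNReal.tsum_set_one]
  refine tsum_congr fun x => ?_
  rw [lintegral_indicator (Square.measurableSet_toSet _), setLIntegral_const,
    Measure.restrict_apply (Square.measurableSet_toSet _),
    inter_eq_self_of_subset_left (hJ x x.2), ENNReal.inv_mul_cancel]
  · rw [Square.volume_toSet, gridBox_width]
    have : 0 < ENNReal.ofReal (B₀.width / 2 ^ x.1.1) := ENNReal.ofReal_pos.2 (by positivity)
    positivity
  · rw [Square.volume_toSet]
    exact ENNReal.pow_ne_top ENNReal.ofReal_ne_top

theorem children_eq_image (B : Square) : B.children ⊆ (fun p : Bool × Bool =>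
    (⟨⟨B.center.re + (if p.1 then 1 else -1) * (B.width / 4),
      B.center.im + (if p.2 then 1 else -1) * (B.width / 4)⟩, B.width / 2⟩ : Square)) '' univ := by
  rintro B' ⟨hw, hre, him⟩
  have aux : ∀ b c w : ℝ, (c = b - w / 4 ∨ c = b + w / 4) →
      ∃ t : Bool, b + (if t then 1 else -1) * (w / 4) = c := by
    rintro b c w (rfl | rfl)
    · exact ⟨false, by simp; ring⟩
    · exact ⟨true, by simp⟩
  obtain ⟨t₁, h₁⟩ := aux _ _ _ hre
  obtain ⟨t₂, h₂⟩ := aux _ _ _ him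
  exact ⟨(t₁, t₂), trivial, Square.ext (Complex.ext h₁ h₂) hw.symm⟩

/-! ### The size of the tree -/

/-- The indices of the internal nodes of the subdivision tree. -/
def internalNodes (A : Access) (N₀ : ℕ) (B₀ : Square) : Set (ℕ × ℕ × ℕ) :=
  {x | x.2.1 < 2 ^ x.1 ∧ x.2.2 < 2 ^ x.1 ∧ InTree A N₀ B₀ (gridBox B₀ x) ∧
    firstC A N₀ (gridBox B₀ x) = -1}

theorem exists_cover_subdivisionTree (A : Access) (N₀ : ℕ) (B₀ : Square) :
    ∃ φ : (ℕ × ℕ × ℕ) × (Bool × Bool) → Square,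
      subdivisionTree A N₀ B₀ ⊆ insert B₀ (φ '' (internalNodes A N₀ B₀ ×ˢ univ)) := by
  refine ⟨fun q => ⟨⟨(gridBox B₀ q.1).center.re +
        (if q.2.1 then 1 else -1) * ((gridBox B₀ q.1).width / 4),
      (gridBox B₀ q.1).center.im + (if q.2.2 then 1 else -1) * ((gridBox B₀ q.1).width / 4)⟩,
      (gridBox B₀ q.1).width / 2⟩, ?_⟩
  intro B hB
  cases (show InTree A N₀ B₀ B from hB) with
  | root => exact mem_insert _ _
  | child hP hfirst hc =>
    obtain ⟨x, h₁, h₂, rfl⟩ := hP.exists_gridBox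
    obtain ⟨p, -, hp⟩ := children_eq_image _ hc
    exact mem_insert_of_mem _ ⟨(x, p), ⟨⟨h₁, h₂, hP, hfirst⟩, trivial⟩, hp⟩

theorem encard_subdivisionTree_le (A : Access) (N₀ : ℕ) (B₀ : Square) :
    ((subdivisionTree A N₀ B₀).encard : ℝ≥0∞) ≤ 1 + 4 * (internalNodes A N₀ B₀).encard := by
  obtain ⟨φ, hφ⟩ := exists_cover_subdivisionTree A N₀ B₀
  have h : (subdivisionTree A N₀ B₀).encard ≤ (internalNodes A N₀ B₀).encard * 4 + 1 := by
    refine (encard_le_encard hφ).trans ((encard_insert_le _ _).trans ?_)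
    gcongr
    refine (encard_image_le _ _).trans_eq ?_
    rw [encard_prod]
    congr 1
    rw [encard_univ, ENat.card_eq_coe_fintype_card]
    rfl
  rw [add_comm, mul_comm]
  exact_mod_cast ENat.toENNReal_le.2 h

theorem finite_subdivisionTree {A : Access} {N₀ : ℕ} {B₀ : Square}
    (h : (internalNodes A N₀ B₀).Finite) : (subdivisionTree A N₀ B₀).Finite := by
  obtain ⟨φ, hφ⟩ := exists_cover_subdivisionTree A N₀ B₀
  exact (((h.prod finite_univ).image φ).insert B₀).subset hφ

/-! ### Finiteness of the tree, and integral bounds for the number of internal nodes -/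

namespace Admissible

variable {Ω : Set ℂ} {f : ℂ → ℂ} {B₀ : Square} {N₀ : ℕ} {A : Access}

/-- A root `z` of `f` is interior to `D_C / 3` for a maximal cluster `C` containing it, since roots
are within an eighth of the radius of `D_C` from the centroid. Away from the roots, `γ` is locally
bounded. Compactness of `B₀` makes the bound uniform in `finite_internalNodes`. -/
theorem exists_width_lower_bound_near (h : Admissible Ω f B₀ N₀ A) {z : ℂ} (hz : z ∈ B₀.toSet) :
    ∃ U ∈ 𝓝 z, ∃ δ : ℝ, 0 < δ ∧ ∀ B, InTree A N₀ B₀ B → firstC A N₀ B = -1 →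
      (B.toSet ∩ U).Nonempty → δ ≤ B.width := by
  have han := h.analyticAt (h.subset (h.two_subset (h.toSet_subset_two hz)))
  by_cases hfz : f z = 0
  · obtain ⟨C, hC, hzC⟩ := h.exists_maximalCluster hz hfz
    have hstrong := (strong_of_mem_maximalClusters hC).1
    have hpos := hstrong.1.discRadius_pos h.isOpen h.differentiableOn
    have hlt : edist z (centroid C) < discRadius f C / 3 := by
      rcases eq_or_ne (discRadius f C) ∞ with htop | htop
      · rw [htop, ENNReal.top_div_of_ne_top (by norm_num)]
        exact edist_lt_top _ _
      · refine (hstrong.edist_centroid_le hzC).trans_lt ?_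
        rw [div_eq_mul_inv, div_eq_mul_inv]
        refine ENNReal.mul_lt_mul_right hpos.ne' htop ?_
        rw [ENNReal.inv_lt_inv]
        norm_num
    obtain ⟨δ, hδ0, hδ⟩ := ENNReal.lt_iff_exists_nnreal_btwn.1
      (ENNReal.div_pos hpos.ne' (by norm_num) : 0 < discRadius f C / 4)
    refine ⟨Metric.eball (centroid C) (discRadius f C / 3),
      Metric.isOpen_eball.mem_nhds (Metric.mem_eball.2 hlt), δ, by exact_mod_cast hδ0, ?_⟩
    rintro B hB hfirst ⟨w, hwB, hwU⟩
    have hw0 := (hB.geometry h.width_pos).1.le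
    have h₁ := hδ.trans (h.discRadius_lt hC hB hfirst hwB (Metric.eball_subset_closedEBall hwU))
    rw [← ENNReal.ofReal_coe_nnreal] at h₁
    exact (ENNReal.ofReal_lt_ofReal_iff'.1 h₁).1.le.trans (Square.radius_le_width hw0)
  · obtain ⟨Γ, hΓ⟩ := eventually_smaleGamma_le han hfz
    refine ⟨_, hΓ.and (han.continuousAt.eventually_ne hfz), 1 / (2000 * max Γ 1), by positivity, ?_⟩
    rintro B hB hfirst ⟨w, hwB, hwΓ, hfw⟩
    have hw0 := (hB.geometry h.width_pos).1
    have hr := Square.radius_pos hw0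
    have h₁ := (h.lt_smaleGamma hB hfirst hwB hfw).trans_le hwΓ
    have h₂ := ((ENNReal.ofReal_lt_ofReal_iff'.1 h₁).1).trans_le (le_max_left Γ 1)
    refine le_trans ?_ (Square.radius_le_width hw0.le)
    rw [div_lt_iff₀ (by positivity)] at h₂
    rw [div_le_iff₀ (by positivity)]
    linarith

theorem finite_internalNodes (h : Admissible Ω f B₀ N₀ A) :
    (internalNodes A N₀ B₀).Finite := by
  obtain ⟨δ, hδ, hδB⟩ : ∃ δ : ℝ, 0 < δ ∧ ∀ B, InTree A N₀ B₀ B → firstC A N₀ B = -1 →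
      (B.toSet ∩ B₀.toSet).Nonempty → δ ≤ B.width := by
    refine B₀.isCompact_toSet.induction_on (p := fun U => ∃ δ : ℝ, 0 < δ ∧ ∀ B,
      InTree A N₀ B₀ B → firstC A N₀ B = -1 → (B.toSet ∩ U).Nonempty → δ ≤ B.width) ?_ ?_ ?_ ?_
    · exact ⟨1, one_pos, by simp⟩
    · rintro s t hst ⟨δ, hδ, hB⟩
      exact ⟨δ, hδ, fun B h₁ h₂ h₃ => hB B h₁ h₂ (h₃.mono (inter_subset_inter_right _ hst))⟩
    · rintro s t ⟨δ₁, hδ₁, hB₁⟩ ⟨δ₂, hδ₂, hB₂⟩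
      refine ⟨min δ₁ δ₂, lt_min hδ₁ hδ₂, fun B h₁ h₂ h₃ => ?_⟩
      rw [inter_union_distrib_left, union_nonempty] at h₃
      rcases h₃ with h₃ | h₃
      · exact (min_le_left _ _).trans (hB₁ B h₁ h₂ h₃)
      · exact (min_le_right _ _).trans (hB₂ B h₁ h₂ h₃)
    · intro z hz
      obtain ⟨U, hU, hδ⟩ := h.exists_width_lower_bound_near hz
      exact ⟨U, nhdsWithin_le_nhds hU, hδ⟩
  obtain ⟨N, hN⟩ := pow_unbounded_of_one_lt (B₀.width / δ) (by norm_num : (1 : ℝ) < 2)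
  refine ((finite_Iic N).prod ((finite_Iio (2 ^ N)).prod (finite_Iio (2 ^ N)))).subset ?_
  rintro ⟨n, i, j⟩ ⟨hi, hj, hB, hfirst⟩
  have hgeo := hB.geometry h.width_pos
  have hc := Square.mem_toSet_center hgeo.1.le
  have hw := hδB _ hB hfirst ⟨_, hc, hgeo.2.2 hc⟩
  rw [gridBox_width, le_div_iff₀ (by positivity), mul_comm, ← le_div_iff₀ hδ] at hw
  have hnN : n ≤ N := by
    have := hw.trans_lt hN
    exact ((pow_lt_pow_iff_right₀ (by norm_num)).1 this).le
  have h2 : 2 ^ n ≤ 2 ^ N := Nat.pow_le_pow_right (by norm_num) hnN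
  exact ⟨hnN, lt_of_lt_of_le hi h2, lt_of_lt_of_le hj h2⟩

theorem inv_volume_le_smaleGamma (h : Admissible Ω f B₀ N₀ A) {B : Square}
    (hB : InTree A N₀ B₀ B) (hfirst : firstC A N₀ B = -1) {z : ℂ} (hz : z ∈ B.toSet)
    (hfz : f z ≠ 0) : (volume B.toSet)⁻¹ ≤ 2 * 10 ^ 6 * smaleGamma f z ^ 2 := by
  have hw := (hB.geometry h.width_pos).1
  have hr := Square.radius_pos hw
  have h₁ := (h.lt_smaleGamma hB hfirst hz hfz).le
  have e : (volume B.toSet)⁻¹ = 2 * 10 ^ 6 * ENNReal.ofReal (1 / (2000 * B.radius)) ^ 2 := by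
    rw [Square.volume_toSet, ← ENNReal.ofReal_pow hw.le, ← ENNReal.ofReal_inv_of_pos (by positivity),
      ← ENNReal.ofReal_pow (by positivity), ← Square.two_mul_radius_sq,
      show (2 * 10 ^ 6 : ℝ≥0∞) = ENNReal.ofReal (2 * 10 ^ 6) by norm_num,
      ← ENNReal.ofReal_mul (by positivity)]
    congr 1
    field_simp
    norm_num
  rw [e]
  gcongr

theorem inv_volume_le_discRadius (h : Admissible Ω f B₀ N₀ A) {C : Multiset ℂ}
    (hC : C ∈ maximalClusters Ω f B₀) {B : Square} (hB : InTree A N₀ B₀ B)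
    (hfirst : firstC A N₀ B = -1) {z : ℂ} (hz : z ∈ B.toSet) (hzC : z ∈ thirdDisc f C) :
    (volume B.toSet)⁻¹ ≤ 8 * (discRadius f C ^ 2)⁻¹ := by
  have hw := (hB.geometry h.width_pos).1
  have h₁ := (h.discRadius_lt hC hB hfirst hz hzC).le
  have hpos := (strong_of_mem_maximalClusters hC).1.1.discRadius_pos h.isOpen h.differentiableOn
  have hne : discRadius f C ≠ ∞ := by
    intro h0
    rw [h0, ENNReal.top_div_of_ne_top (by norm_num)] at h₁
    exact ENNReal.ofReal_ne_top (top_le_iff.1 h₁)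
  have hρ := ENNReal.toReal_pos hpos.ne' hne
  rw [← ENNReal.ofReal_toReal hne] at h₁ ⊢
  set ρ := (discRadius f C).toReal
  have e4 : ENNReal.ofReal ρ / 4 = ENNReal.ofReal (ρ / 4) := by
    rw [ENNReal.ofReal_div_of_pos (by positivity)]; norm_num
  rw [e4, ENNReal.ofReal_le_ofReal_iff (Square.radius_pos hw).le] at h₁
  rw [Square.volume_toSet, ← ENNReal.ofReal_pow hw.le, ← ENNReal.ofReal_inv_of_pos (by positivity),
    ← ENNReal.ofReal_pow hρ.le, ← ENNReal.ofReal_inv_of_pos (by positivity),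
    show (8 : ℝ≥0∞) = ENNReal.ofReal 8 by norm_num, ← ENNReal.ofReal_mul (by positivity)]
  refine ENNReal.ofReal_le_ofReal ?_
  rw [← Square.two_mul_radius_sq, ← div_eq_mul_inv, ← one_div,
    div_le_div_iff₀ (by have := Square.radius_pos hw; positivity) (by positivity)]
  nlinarith

theorem volume_thirdDisc_mul_le (h : Admissible Ω f B₀ N₀ A) {C : Multiset ℂ}
    (hC : C ∈ maximalClusters Ω f B₀) :
    8 * (8 * (discRadius f C ^ 2)⁻¹) * volume (thirdDisc f C) ≤ 64 := by
  have hpos := (strong_of_mem_maximalClusters hC).1.1.discRadius_pos h.isOpen h.differentiableOn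
  -- For an infinite radius the first factor is 0, and `0 * ∞ = 0`.
  rcases eq_or_ne (discRadius f C) ∞ with hne | hne
  · simp [hne]
  have hρ := ENNReal.toReal_pos hpos.ne' hne
  have e3 : discRadius f C / 3 = ENNReal.ofReal ((discRadius f C).toReal / 3) := by
    rw [ENNReal.ofReal_div_of_pos (by positivity), ENNReal.ofReal_toReal hne]; norm_num
  rw [thirdDisc_eq, e3, Metric.closedEBall_ofReal (by positivity), Complex.volume_closedBall,
    ← ENNReal.ofReal_toReal hne]
  simp only [ENNReal.toReal_ofReal hρ.le]
  set ρ := (discRadius f C).toReal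
  have hpi : ((NNReal.pi : ℝ≥0) : ℝ≥0∞) = ENNReal.ofReal Real.pi := by
    rw [← NNReal.coe_real_pi, ENNReal.ofReal_coe_nnreal]
  rw [hpi, ← ENNReal.ofReal_pow hρ.le, ← ENNReal.ofReal_inv_of_pos (by positivity),
    ← ENNReal.ofReal_pow (by positivity), show (8 : ℝ≥0∞) = ENNReal.ofReal 8 by norm_num,
    show (64 : ℝ≥0∞) = ENNReal.ofReal 64 by norm_num, ← ENNReal.ofReal_mul (by positivity),
    ← ENNReal.ofReal_mul (by positivity), ← ENNReal.ofReal_mul (by positivity),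
    ← ENNReal.ofReal_mul (by positivity)]
  refine ENNReal.ofReal_le_ofReal ?_
  have : 8 * (8 * (ρ ^ 2)⁻¹) * ((ρ / 3) ^ 2 * Real.pi) = 64 / 9 * Real.pi := by
    field_simp
    norm_num
  rw [this]
  linarith [Real.pi_le_four]

theorem encard_internalNodes_le (h : Admissible Ω f B₀ N₀ A) :
    ((internalNodes A N₀ B₀).encard : ℝ≥0∞) ≤
      16 * 10 ^ 6 * gammaIntegral Ω f B₀ + 64 * (maximalClusters Ω f B₀).encard := by
  set J := internalNodes A N₀ B₀
  set G : ℂ → ℝ≥0∞ := fun z => ∑' x : J,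
    (gridBox B₀ x).toSet.indicator (fun _ => (volume (gridBox B₀ x).toSet)⁻¹) z with hG
  have hcover : B₀.toSet ⊆ exclusionRegion Ω f B₀ ∪
      ⋃ C : maximalClusters Ω f B₀, thirdDisc f C := by
    intro z hz
    by_cases hzC : z ∈ ⋃ C ∈ maximalClusters Ω f B₀, thirdDisc f C
    · right
      rwa [biUnion_eq_iUnion] at hzC
    · exact .inl ⟨hz, hzC⟩
  have : Countable (maximalClusters Ω f B₀) := h.finite_maximalClusters.countable.to_subtype
  calc ((internalNodes A N₀ B₀).encard : ℝ≥0∞) = ∫⁻ z in B₀.toSet, G z :=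
        encard_eq_lintegral h.width_pos J fun x hx => (hx.2.2.1.geometry h.width_pos).2.2
    _ ≤ ∫⁻ z in exclusionRegion Ω f B₀ ∪ ⋃ C : maximalClusters Ω f B₀, thirdDisc f C, G z :=
        lintegral_mono_set hcover
    _ ≤ (∫⁻ z in exclusionRegion Ω f B₀, G z) +
        ∫⁻ z in ⋃ C : maximalClusters Ω f B₀, thirdDisc f C, G z := lintegral_union_le _ _ _
    _ ≤ 16 * 10 ^ 6 * gammaIntegral Ω f B₀ + 64 * (maximalClusters Ω f B₀).encard := by
      refine add_le_add ?_ ?_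
      · rw [gammaIntegral, ← lintegral_const_mul' _ _ (by finiteness)]
        refine setLIntegral_mono' h.measurableSet_exclusionRegion fun z hz => ?_
        refine (tsum_inv_volume_le h.width_pos J z _ fun x hx hzx =>
          h.inv_volume_le_smaleGamma hx.2.2.1 hx.2.2.2 hzx
            (h.ne_zero_of_mem_exclusionRegion hz)).trans_eq ?_
        rw [← mul_assoc]
        norm_num
      · refine (lintegral_iUnion_le _ _).trans ?_
        rw [mul_comm, ← ENNReal.tsum_set_const]
        refine ENNReal.tsum_le_tsum fun C => ?_
        refine le_trans ?_ (h.volume_thirdDisc_mul_le C.2)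
        rw [← setLIntegral_const]
        refine setLIntegral_mono' Metric.isClosed_closedEBall.measurableSet fun z hz => ?_
        exact tsum_inv_volume_le h.width_pos J z _ fun x hx hzx =>
          h.inv_volume_le_discRadius C.2 hx.2.2.1 hx.2.2.2 hzx hz

theorem gammaIntegral_le_univalenceIntegral (h : Admissible Ω f B₀ N₀ A) :
    gammaIntegral Ω f B₀ ≤ 10 ^ 10 * univalenceIntegral Ω f B₀ := by
  rw [gammaIntegral, univalenceIntegral, ← lintegral_const_mul' _ _ (by finiteness)]
  refine setLIntegral_mono' h.measurableSet_exclusionRegion fun z hz => ?_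
  have := smaleGamma_le_div_univalenceRadius h.differentiableOn
    (h.ne_zero_of_mem_exclusionRegion hz)
  calc smaleGamma f z ^ 2 ≤ (10 ^ 5 / univalenceRadius Ω f z) ^ 2 := by gcongr
    _ = _ := by
      rw [div_eq_mul_inv, mul_pow, ← ENNReal.inv_pow, one_div, ← pow_mul]

end Admissible

end RootClustering

/-! ### Collecting the constants -/

theorem mainTheorem1 :
    ∃ (M : ℝ≥0) (K : ℝ), ∀ (Ω : Set ℂ) (f : ℂ → ℂ) (B₀ : RootClustering.Square) (N₀ : ℕ)
      (A : RootClustering.Access),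
      IsOpen Ω → DifferentiableOn ℂ f Ω → 0 < B₀.width →
      (B₀.scale (K * (N₀ + 1))).toSet ⊆ Ω →
      (∃ z ∈ B₀.toSet, f z ≠ 0) →
      A.Valid Ω f →
      (∀ C : Multiset ℂ, RootClustering.IsRootMultiset f B₀.toSet C → Multiset.card C ≤ N₀) →
      (∀ C ∈ RootClustering.maximalClusters Ω f B₀, Multiset.card C ≤ N₀) →
      (RootClustering.subdivisionTree A N₀ B₀).Finite ∧
      ((RootClustering.subdivisionTree A N₀ B₀).encard : ℝ≥0∞) ≤
        M * (1 + ((RootClustering.maximalClusters Ω f B₀).encard : ℝ≥0∞) +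
          RootClustering.gammaIntegral Ω f B₀) ∧
      ((RootClustering.maximalClusters Ω f B₀).encard : ℝ≥0∞) +
          RootClustering.gammaIntegral Ω f B₀ ≤
        M * (((RootClustering.maximalClusters Ω f B₀).encard : ℝ≥0∞) +
          RootClustering.univalenceIntegral Ω f B₀) ∧
      ((RootClustering.subdivisionTree A N₀ B₀).encard : ℝ≥0∞) ≤
        M * (1 + ((RootClustering.maximalClusters Ω f B₀).encard : ℝ≥0∞) +
          RootClustering.univalenceIntegral Ω f B₀) := by
  -- `10^18` is the product of the `10^8` of the size bound and the `10^10` that comes from squaring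
  -- `γ ≤ 10^5 / R_f`.
  refine ⟨10 ^ 18, 10000, fun Ω f B₀ N₀ A hΩ hf hw hsub hne hA _ hcard => ?_⟩
  have h : RootClustering.Admissible Ω f B₀ N₀ A := ⟨hΩ, hf, hw, hsub, hne, hA, hcard⟩
  have htree := RootClustering.encard_subdivisionTree_le A N₀ B₀
  have hint := h.encard_internalNodes_le
  have huni := h.gammaIntegral_le_univalenceIntegral
  set S : ℝ≥0∞ := ((RootClustering.maximalClusters Ω f B₀).encard : ℝ≥0∞)
  set γI := RootClustering.gammaIntegral Ω f B₀
  set U := RootClustering.univalenceIntegral Ω f B₀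
  have hsize : ((RootClustering.subdivisionTree A N₀ B₀).encard : ℝ≥0∞) ≤
      10 ^ 8 * (1 + S + γI) := by
    calc _ ≤ 1 + 4 * (16 * 10 ^ 6 * γI + 64 * S) := htree.trans (by gcongr)
      _ = 1 + 256 * S + 64 * 10 ^ 6 * γI := by ring
      _ ≤ 10 ^ 8 * 1 + 10 ^ 8 * S + 10 ^ 8 * γI := by
        gcongr <;> norm_num
      _ = _ := by ring
  have hSU : S + γI ≤ 10 ^ 10 * (S + U) := by
    rw [mul_add]
    refine add_le_add ?_ huni
    exact le_mul_of_one_le_left zero_le (by norm_num)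
  push_cast
  refine ⟨RootClustering.finite_subdivisionTree h.finite_internalNodes, ?_, ?_, ?_⟩
  · refine hsize.trans ?_
    gcongr <;> norm_num
  · refine hSU.trans ?_
    gcongr <;> norm_num
  · calc _ ≤ 10 ^ 8 * (1 + (S + γI)) := by rw [← add_assoc]; exact hsize
      _ ≤ 10 ^ 8 * (10 ^ 10 * 1 + 10 ^ 10 * (S + U)) := by
        gcongr
        norm_num
      _ = 10 ^ 18 * (1 + S + U) := by ring
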